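/- Let $L$ be a language with finitely many relation symbols, no function or constant symbols, and at least one ternary relation symbol. For a finite $L$-structure $A$ put $\delta(A)=|A|-\sum_{R\in L}|R[A]|$, where $R[A]$ is the set of tuples from $A$ satisfying $R$. For finite $A\subseteq B$ write $A\le B$ if $\delta(A)<\delta(B')$ whenever $A\subsetneq B'\subseteq B$; for a subset $A$ of an arbitrary $L$-structure $M$ write $A\le M$ if $A\cap X\le X$ for all finite $X\subseteq M$. A $\le$-embedding $\alpha:A\to B$ is an embedding with $\alpha(A)\le B$. Let $f:[0,\infty)\to\mathbb{R}$ be continuous and increasing with $f(x)\to\infty$ as $x\to\infty$, and suppose that $f$ has at every $x\ge 0$ a right derivative $f'(x)$, that $f'$ is non-increasing, and that $f'(x)\le \frac{1}{2(x+1)}$ for all $x\ge 0$. Let $\mathcal{K}_f$ be the class of finite $L$-structures $B$ with $\emptyset\le B$ and $\delta(X)\ge f(|X|)$ for all $X\subseteq B$. Let $M_f$ be the generic structure of $(\mathcal{K}_f,\le)$, that is, an $L$-structure such that: 1. $M_f$ is the union of a chain of finite substructures $S\le M_f$ which belong to $\mathcal{K}_f$; 2. if $A\le M_f$ is finite and $A\le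 B\in\mathcal{K}_f$, there is a $\le$-embedding $\beta:B\to M_f$ with $\beta(a)=a$ for all $a\in A$. Write $\mathrm{acl}$ for model-theoretic algebraic closure in $M_f$. Let $\bar a$ be a finite tuple in $M_f$, let $b\in M_f$ with $b\notin\mathrm{acl}(\bar a)$, and let $P=\mathrm{loc}(b/\bar a)$ be the set of realizations in $M_f$ of the type $\mathrm{tp}_L(b/\bar a)$. Then for every $r\in\mathbb{N}$ and every $\bar y\in M_f^{\,r}$ there is some $\bar x\in P^{r+2}$ such that every coordinate of $\bar y$ lies in $\mathrm{acl}(\bar x\bar a)$. -/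

import Mathlib

open scoped FirstOrder

universe u v w

namespace HrushovskiGeneric


/-- The predimension `δ(X) = |X| - ∑_R |R[X]|` of a finite subset `X` of an `L`-structure,
viewed as a substructure; `R[X]` is the set of tuples from `X` that satisfy `R`. -/
noncomputable def predim (L : FirstOrder.Language.{v, w}) [Fintype (Σ n, L.Relations n)]
    {M : Type u} [L.Structure M] (X : Finset M) : ℤ :=
  (X.card : ℤ) - ∑ R : Σ n, L.Relations n,
    (Set.ncard {t : Fin R.1 → M | FirstOrder.Language.Structure.RelMap R.2 t ∧ ∀ i, t i ∈ X} : ℤ)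

/-- `A ≤ B` for finite `A ⊆ B`: `δ(A) < δ(B')` whenever `A ⊂ B' ⊆ B`. -/
def FinLE (L : FirstOrder.Language.{v, w}) [Fintype (Σ n, L.Relations n)]
    {M : Type u} [L.Structure M] (A B : Finset M) : Prop :=
  A ⊆ B ∧ ∀ B' : Finset M, A ⊂ B' → B' ⊆ B → predim L A < predim L B'

open Classical in
/-- `A ≤ M` (`A` is self-sufficient in `M`) for a subset `A` of an arbitrary structure `M`:
`A ∩ X ≤ X` for all finite `X ⊆ M`. -/
def SelfSufficient (L : FirstOrder.Language.{v, w}) [Fintype (Σ n, L.Relations n)]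
    {M : Type u} [L.Structure M] (A : Set M) : Prop :=
  ∀ X : Finset M, FinLE L (X.filter (· ∈ A)) X

/-- The structure `B` belongs to the class `K_f`: it is finite, `∅ ≤ B`, and
`δ(X) ≥ f(|X|)` for all `X ⊆ B`. -/
structure MemKf (L : FirstOrder.Language.{v, w}) [Fintype (Σ n, L.Relations n)] (f : ℝ → ℝ)
    (B : Type u) [L.Structure B] : Prop where
  finite : Finite B
  empty_le : SelfSufficient L (∅ : Set B)
  le_predim : ∀ X : Finset B, f X.card ≤ (predim L X : ℝ)

/-- `M` is (a copy of) the generic structure `M_f` of the class `(K_f, ≤)`. -/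
structure IsGeneric (L : FirstOrder.Language.{v, w}) [Fintype (Σ n, L.Relations n)] (f : ℝ → ℝ)
    (M : Type u) [L.Structure M] : Prop where
  /-- `M` is the union of a chain of finite self-sufficient substructures in `K_f`. -/
  exists_chain : ∃ S : ℕ → L.Substructure M, Monotone S ∧
    (∀ i, MemKf L f (S i) ∧ SelfSufficient L (S i : Set M)) ∧ ∀ x : M, ∃ i, x ∈ S i
  /-- The `≤`-extension property: if `A ≤ M` is finite and `i : A → B` is a `≤`-embedding into
  some `B` in `K_f`, there is a `≤`-embedding `β : B → M` with `β ∘ i` the inclusion of `A`. -/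
  extension : ∀ A : L.Substructure M, Finite A → SelfSufficient L (A : Set M) →
    ∀ (B : Type u) [L.Structure B], MemKf L f B →
    ∀ i : A ↪[L] B, SelfSufficient L (Set.range i) →
      ∃ β : B ↪[L] M, SelfSufficient L (Set.range β) ∧ ∀ x : A, β (i x) = (x : M)

/-- The conditions on the control function `f` on `[0, ∞)`: continuous, increasing, unbounded,
with a non-increasing right derivative `f'` such that `f'(x) ≤ 1/(x+1)`. -/
structure IsGood (f f' : ℝ → ℝ) : Prop where
  continuousOn : ContinuousOn f (Set.Ici 0)
  monotoneOn : MonotoneOn f (Set.Ici 0)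
  tendsto : Filter.Tendsto f Filter.atTop Filter.atTop
  hasDerivWithinAt : ∀ x, 0 ≤ x → HasDerivWithinAt f (f' x) (Set.Ioi x) x
  antitoneOn : AntitoneOn f' (Set.Ici 0)
  deriv_le : ∀ x, 0 ≤ x → f' x ≤ 1 / (x + 1)

/-- The model-theoretic algebraic closure of `A` in `M`: the union of all finite subsets of `M`
definable with parameters from `A`. -/
def acl (L : FirstOrder.Language.{v, w}) {M : Type u} [L.Structure M] (A : Set M) : Set M :=
  {x | ∃ D : Set M, A.Definable₁ L D ∧ D.Finite ∧ x ∈ D}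

/-- The complete type `tp(b/A)`: all formulas in one variable with parameters from `A` that
`b` satisfies. -/
def typeOver (L : FirstOrder.Language.{v, w}) {M : Type u} [L.Structure M] (A : Set M) (b : M) :
    Set (L[[A]].Formula Unit) :=
  {φ | φ.Realize (fun _ : Unit => b)}

/-- The locus `loc(b/A)`: the set of realizations in `M` of `tp(b/A)`. -/
def loc (L : FirstOrder.Language.{v, w}) {M : Type u} [L.Structure M] (A : Set M) (b : M) : Set M :=
  {c | ∀ φ ∈ typeOver L A b, φ.Realize (fun _ : Unit => c)}

end HrushovskiGeneric

/-! Let `A` be the self-sufficient closure of the tuple `a`. It is contained in acl(`a`)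
(`IsClosure.subset_acl`), so `b ∉ A`. From the coordinates of `y` choose a minimal `J` whose closure
`C` over `A` contains all of them; minimality makes `J` independent, so each point of `J` adds at
least 1 to the predimension over `A`.

Amalgamate |J| + 1 copies of `b` freely over `A` with `C`, one central and one for each `j ∈ J`, and
add for each `j` one fact relating the central copy, the copy for `j`, and `j`. There is one link
fewer than there are copies, so `C` stays self-sufficient; independence of `J` pays for the links
seen from a copy, so each copy stays self-sufficient too. The slow growth of `f` keeps the amalgam
in the class (`Amalgam.le_predim`). By genericity it is realized in `M` over `C`, and back-and-forth
(`IsGeneric.realize_iff`) shows that the copies of `b` realize its type over `a`.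

Let `K` be the closure of these realizations together with `a`. Relative to `K` each point of `J`
outside `K` gains one but is tied to `K` by one link, so adjoining `C` does not raise the
predimension; self-sufficiency of `K` forces `C ⊆ K` (`subset_of_linked`). Hence `y` lies in `K`,
which is algebraic over `x` and `a`. -/

namespace HrushovskiGeneric

/-! ### Predimension and self-sufficient sets -/

section Predimension

open Classical FirstOrder Language Structure

variable {L : FirstOrder.Language.{v, w}} {M : Type u} {N : Type*}

/-- A relation symbol together with a tuple of elements of the right length. -/
abbrev Fact (L : FirstOrder.Language.{v, w}) (M : Type*) := Σ R : (Σ n, L.Relations n), (Fin R.1 → M)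

/-- The fact `p` holds in the structure `M`. -/
def Fact.Holds [L.Structure M] (p : Fact L M) : Prop := RelMap p.1.2 p.2

/-- The image of a fact under a map. -/
def Fact.map (g : M → N) (p : Fact L M) : Fact L N := ⟨p.1, g ∘ p.2⟩

theorem Fact.map_injective {g : M → N} (hg : Function.Injective g) :
    Function.Injective (Fact.map (L := L) g) := by
  rintro ⟨R, t⟩ ⟨R', t'⟩ h
  simp only [Fact.map, Sigma.mk.injEq] at h
  obtain ⟨rfl, h⟩ := h
  have := hg.comp_left (eq_of_heq h)
  subst this
  rfl

theorem Fact.map_holds [L.Structure M] [L.Structure N] (g : M ↪[L] N) (p : Fact L M) :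
    (p.map g).Holds ↔ p.Holds :=
  g.map_rel p.1.2 p.2

variable [Fintype (Σ n, L.Relations n)]

/-- The facts that hold in the finite set `X`. -/
noncomputable def facts (L : FirstOrder.Language.{v, w}) [Fintype (Σ n, L.Relations n)]
    [L.Structure M] (X : Finset M) : Finset (Fact L M) :=
  Finset.univ.sigma fun R => (Fintype.piFinset fun _ => X).filter fun t => RelMap R.2 t

variable [L.Structure M] [L.Structure N]

theorem mem_facts {X : Finset M} {p : Fact L M} :
    p ∈ facts L X ↔ p.Holds ∧ ∀ i, p.2 i ∈ X := by
  simp [facts, Fact.Holds, and_comm]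

theorem predim_eq (X : Finset M) : predim L X = (X.card : ℤ) - (facts L X).card := by
  unfold predim facts
  rw [Finset.card_sigma]
  push_cast
  congr 1
  refine Finset.sum_congr rfl fun R _ => ?_
  rw [← Set.ncard_coe_finset]
  congr 2
  ext t
  simp [and_comm]

theorem facts_mono {X Y : Finset M} (h : X ⊆ Y) : facts L X ⊆ facts L Y := fun p hp => by
  rw [mem_facts] at hp ⊢
  exact ⟨hp.1, fun i => h (hp.2 i)⟩

theorem facts_map (g : M ↪[L] N) (X : Finset M) :
    facts L (X.map g.toEmbedding) = (facts L X).map ⟨Fact.map g, Fact.map_injective g.injective⟩ := by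
  ext q
  simp only [mem_facts, Finset.mem_map, Function.Embedding.coeFn_mk]
  constructor
  · rintro ⟨h, hq⟩
    obtain ⟨R, t⟩ := q
    obtain ⟨t', ht', rfl⟩ : ∃ t' : Fin R.1 → M, (∀ i, t' i ∈ X) ∧ g ∘ t' = t := by
      choose t' ht' using hq
      exact ⟨t', fun i => (ht' i).1, funext fun i => (ht' i).2⟩
    exact ⟨⟨R, t'⟩, ⟨(Fact.map_holds g ⟨R, t'⟩).1 h, ht'⟩, rfl⟩
  · rintro ⟨p, ⟨h, hp⟩, rfl⟩
    exact ⟨(Fact.map_holds g p).2 h, fun i => ⟨p.2 i, hp i, rfl⟩⟩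

theorem predim_map (g : M ↪[L] N) (X : Finset M) :
    predim L (X.map g.toEmbedding) = predim L X := by
  simp [predim_eq, facts_map]

/-- Facts lying in both sets are exactly those of the intersection, and each fact of `G` straddles
the two sets and costs one more. The set `G` is there for the links; `G = ∅` is submodularity. -/
theorem predim_union_le_of_facts {X Y : Finset M} {G : Finset (Fact L M)}
    (hG : ∀ p ∈ G, p ∈ facts L (X ∪ Y) ∧ p ∉ facts L X ∧ p ∉ facts L Y) :
    predim L (X ∪ Y) ≤ predim L X + predim L Y - predim L (X ∩ Y) - G.card := by
  have h1 : facts L X ∩ facts L Y = facts L (X ∩ Y) := by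
    ext p
    simp only [Finset.mem_inter, mem_facts]
    exact ⟨fun h => ⟨h.1.1, fun i => ⟨h.1.2 i, h.2.2 i⟩⟩,
      fun h => ⟨⟨h.1, fun i => (h.2 i).1⟩, ⟨h.1, fun i => (h.2 i).2⟩⟩⟩
  have h2 : (facts L X ∪ facts L Y) ∪ G ⊆ facts L (X ∪ Y) := by
    refine Finset.union_subset (Finset.union_subset (facts_mono Finset.subset_union_left)
      (facts_mono Finset.subset_union_right)) fun p hp => (hG p hp).1
  have h3 : Disjoint (facts L X ∪ facts L Y) G := by
    rw [Finset.disjoint_right]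
    intro p hp
    simp [(hG p hp).2.1, (hG p hp).2.2]
  have h4 := Finset.card_le_card h2
  rw [Finset.card_union_of_disjoint h3] at h4
  have h5 := Finset.card_union_add_card_inter (facts L X) (facts L Y)
  rw [h1] at h5
  have h6 := Finset.card_union_add_card_inter X Y
  simp only [predim_eq]
  omega

theorem predim_submodular (X Y : Finset M) :
    predim L (X ∪ Y) + predim L (X ∩ Y) ≤ predim L X + predim L Y := by
  have := predim_union_le_of_facts (L := L) (X := X) (Y := Y) (G := ∅) (by simp)
  simp at this
  omega

theorem predim_union_le_add_card (X Y : Finset M) :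
    predim L (X ∪ Y) ≤ predim L X + Y.card := by
  have h1 := Finset.card_le_card (facts_mono (L := L) (Finset.subset_union_left (s₁ := X) (s₂ := Y)))
  have h2 := Finset.card_union_le X Y
  simp only [predim_eq]
  omega

/-- Describing the trace `Z` by membership lets it be given as an intersection, a filter or an image
under an embedding. -/
theorem selfSufficient_iff {A : Set M} : SelfSufficient L A ↔
    ∀ X Z : Finset M, (∀ m, m ∈ Z ↔ m ∈ X ∧ m ∈ A) → (∃ m ∈ X, m ∉ A) →
      predim L Z < predim L X := by
  constructor
  · intro h X Z hZ ⟨m, hm, hmA⟩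
    have hZ' : Z = X.filter (· ∈ A) := by ext m; simp [hZ]
    rw [hZ']
    refine (h X).2 X ?_ subset_rfl
    exact Finset.ssubset_iff_subset_ne.2 ⟨Finset.filter_subset _ _,
      fun h' => hmA (Finset.filter_eq_self.1 h' m hm)⟩
  · intro h X
    refine ⟨Finset.filter_subset _ _, fun B' h1 h2 => h B' _ (fun m => ?_) ?_⟩
    · rw [Finset.mem_filter]
      exact ⟨fun hm => ⟨h1.1 (Finset.mem_filter.2 hm), hm.2⟩, fun hm => ⟨h2 hm.1, hm.2⟩⟩
    · obtain ⟨m, hm, hm'⟩ := Finset.exists_of_ssubset h1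
      exact ⟨m, hm, fun hA => hm' (Finset.mem_filter.2 ⟨h2 hm, hA⟩)⟩

theorem SelfSufficient.predim_lt {A : Set M} (h : SelfSufficient L A) {X Z : Finset M}
    (hZ : ∀ m, m ∈ Z ↔ m ∈ X ∧ m ∈ A) (hX : ∃ m ∈ X, m ∉ A) : predim L Z < predim L X :=
  selfSufficient_iff.1 h X Z hZ hX

theorem SelfSufficient.predim_le {A : Set M} (h : SelfSufficient L A) {X Z : Finset M}
    (hZ : ∀ m, m ∈ Z ↔ m ∈ X ∧ m ∈ A) : predim L Z ≤ predim L X := by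
  by_cases hX : ∃ m ∈ X, m ∉ A
  · exact (h.predim_lt hZ hX).le
  · push Not at hX
    have : Z = X := by ext m; rw [hZ]; exact ⟨fun h => h.1, fun h => ⟨h, hX m h⟩⟩
    rw [this]

theorem SelfSufficient.inter {A B : Set M} (hA : SelfSufficient L A) (hB : SelfSufficient L B) :
    SelfSufficient L (A ∩ B) := by
  refine selfSufficient_iff.2 fun X Z hZ ⟨m, hm, hm'⟩ => ?_
  have h1 : ∀ m, m ∈ X.filter (· ∈ A) ↔ m ∈ X ∧ m ∈ A := by simp
  have h2 : ∀ m, m ∈ Z ↔ m ∈ X.filter (· ∈ A) ∧ m ∈ B := by simp [hZ, and_assoc]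
  by_cases hmA : m ∈ A
  · exact (hB.predim_lt h2 ⟨m, by simp [hm, hmA], fun h => hm' ⟨hmA, h⟩⟩).trans_le (hA.predim_le h1)
  · exact (hB.predim_le h2).trans_lt (hA.predim_lt h1 ⟨m, hm, hmA⟩)

/-- Transitivity of self-sufficiency: cut down to the range of `g`, then to `S`; at least one of the
two cuts is strict. -/
theorem SelfSufficient.image (g : N ↪[L] M) (hg : SelfSufficient L (Set.range g)) {S : Set N}
    (hS : SelfSufficient L S) : SelfSufficient L (g '' S) := by
  refine selfSufficient_iff.2 fun X Z hZ ⟨m, hm, hm'⟩ => ?_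
  set X' : Finset N := X.preimage g g.injective.injOn with hX'
  have h1 : ∀ m, m ∈ X'.map g.toEmbedding ↔ m ∈ X ∧ m ∈ Set.range g := by
    intro m
    simp only [Finset.mem_map, hX', Finset.mem_preimage]
    constructor
    · rintro ⟨n, hn, rfl⟩; exact ⟨hn, n, rfl⟩
    · rintro ⟨hm, n, rfl⟩; exact ⟨n, hm, rfl⟩
  have h2 : ∀ n, n ∈ X'.filter (· ∈ S) ↔ n ∈ X' ∧ n ∈ S := by simp
  have h3 : Z = (X'.filter (· ∈ S)).map g.toEmbedding := by
    ext m
    simp only [hZ, Finset.mem_map, Finset.mem_filter, hX', Finset.mem_preimage]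
    constructor
    · rintro ⟨hm, n, hn, rfl⟩; exact ⟨n, ⟨hm, hn⟩, rfl⟩
    · rintro ⟨n, ⟨hm, hn⟩, rfl⟩; exact ⟨hm, n, hn, rfl⟩
  rw [h3, predim_map]
  have e1 := hg.predim_le h1
  have e2 := hS.predim_le h2
  rw [predim_map] at e1
  by_cases hr : m ∈ Set.range g
  · obtain ⟨n, rfl⟩ := hr
    exact (hS.predim_lt h2 ⟨n, by simpa [hX'] using hm, fun h => hm' ⟨n, h, rfl⟩⟩).trans_le e1
  · have := hg.predim_lt h1 ⟨m, hm, hr⟩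
    rw [predim_map] at this
    exact e2.trans_lt this

theorem SelfSufficient.preimage (g : N ↪[L] M) {S : Set M} (hS : SelfSufficient L S) :
    SelfSufficient L (g ⁻¹' S) := by
  refine selfSufficient_iff.2 fun X Z hZ ⟨m, hm, hm'⟩ => ?_
  rw [← predim_map g X, ← predim_map g Z]
  refine hS.predim_lt (fun m => ?_) ⟨g m, Finset.mem_map.2 ⟨m, hm, rfl⟩, hm'⟩
  simp only [Finset.mem_map]
  constructor
  · rintro ⟨n, hn, rfl⟩
    exact ⟨⟨n, ((hZ n).1 hn).1, rfl⟩, ((hZ n).1 hn).2⟩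
  · rintro ⟨⟨n, hn, rfl⟩, h⟩
    exact ⟨n, (hZ n).2 ⟨hn, h⟩, rfl⟩

end Predimension

/-! ### Self-sufficient closure and its algebraicity -/

section Closure

open Classical FirstOrder Language Structure

variable {L : FirstOrder.Language.{v, w}} [Fintype (Σ n, L.Relations n)]
  {M : Type u} [L.Structure M]

/-- `D` is the least finite self-sufficient set containing `X`. -/
structure IsClosure (L : FirstOrder.Language.{v, w}) [Fintype (Σ n, L.Relations n)]
    [L.Structure M] (X D : Finset M) : Prop where
  selfSufficient : SelfSufficient L (D : Set M)
  subset : X ⊆ D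
  least : ∀ D' : Finset M, SelfSufficient L (D' : Set M) → X ⊆ D' → D ⊆ D'

/-- Self-sufficient sets are closed under intersection, so one of least size inside `D₀` is least.
-/
theorem exists_isClosure {X D₀ : Finset M} (h₀ : SelfSufficient L (D₀ : Set M)) (hX : X ⊆ D₀) :
    ∃ D : Finset M, IsClosure L X D := by
  obtain ⟨D, hD, hmin⟩ := Finset.exists_min_image
    (D₀.powerset.filter fun D : Finset M => SelfSufficient L (D : Set M) ∧ X ⊆ D) Finset.card
    ⟨D₀, by simp [h₀, hX]⟩
  simp only [Finset.mem_filter, Finset.mem_powerset] at hD hmin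
  refine ⟨D, hD.2.1, hD.2.2, fun D' h' hX' => ?_⟩
  have h1 : SelfSufficient L ((D ∩ D' : Finset M) : Set M) := by
    rw [Finset.coe_inter]; exact hD.2.1.inter h'
  have h2 := hmin (D ∩ D') ⟨Finset.inter_subset_left.trans hD.1, h1,
    Finset.subset_inter hD.2.2 hX'⟩
  have h3 := Finset.eq_of_subset_of_card_le Finset.inter_subset_left h2
  exact Finset.inter_eq_left.1 h3

/-- A minimizer of the predimension between `X` and `D`, taken as large as possible, is
self-sufficient and hence equals `D`; a set `Y` not inside `D` is first cut down to `D`. -/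
theorem IsClosure.predim_le {X D Y : Finset M} (h : IsClosure L X D) (hY : X ⊆ Y) :
    predim L D ≤ predim L Y := by
  -- Least predimension first, then largest size: the tie-break supplies the strict inequality in
  -- self-sufficiency.
  obtain ⟨Z, hZ, hmin⟩ := Finset.exists_min_image (D.powerset.filter fun Z => X ⊆ Z)
    (fun Z => toLex (predim L Z, -(Z.card : ℤ))) ⟨D, by simp [h.subset]⟩
  simp only [Finset.mem_filter, Finset.mem_powerset, Prod.Lex.toLex_le_toLex] at hZ hmin
  have hZss : SelfSufficient L (Z : Set M) := by
    refine selfSufficient_iff.2 fun V W hW ⟨m, hm, hm'⟩ => ?_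
    have hVD : predim L (V ∩ D) ≤ predim L V :=
      h.selfSufficient.predim_le (fun m => by simp)
    have hWe : W = V ∩ Z := by ext m; simp [hW]
    by_cases hmD : ∃ m ∈ V ∩ D, m ∉ Z
    · refine lt_of_lt_of_le ?_ hVD
      obtain ⟨m', hm1, hm2⟩ := hmD
      have h1 := hmin (Z ∪ (V ∩ D)) ⟨Finset.union_subset hZ.1 Finset.inter_subset_right,
        hZ.2.trans Finset.subset_union_left⟩
      have h2 := predim_submodular (L := L) Z (V ∩ D)
      have h3 : Z ∩ (V ∩ D) = W := by
        rw [hWe]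
        ext x
        simp only [Finset.mem_inter]
        exact ⟨fun hx => ⟨hx.2.1, hx.1⟩, fun hx => ⟨hx.2, hx.1, hZ.1 hx.2⟩⟩
      have h4 : Z.card < (Z ∪ (V ∩ D)).card := by
        refine Finset.card_lt_card (Finset.ssubset_iff_subset_ne.2
          ⟨Finset.subset_union_left, fun he => hm2 ?_⟩)
        rw [he]; exact Finset.mem_union_right _ hm1
      rw [h3] at h2
      omega
    · push Not at hmD
      have hWe' : ∀ m, m ∈ W ↔ m ∈ V ∧ m ∈ (D : Set M) := fun m => by
        rw [hW]
        exact ⟨fun hx => ⟨hx.1, hZ.1 hx.2⟩, fun hx => ⟨hx.1, hmD m (Finset.mem_inter.2 hx)⟩⟩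
      exact h.selfSufficient.predim_lt hWe' ⟨m, hm, fun hD => hm' (hmD m (by simp [hm]; exact hD))⟩
  have hDZ := h.least Z hZss hZ.2
  have hZD : Z = D := hZ.1.antisymm hDZ
  subst hZD
  have h1 := hmin (Y ∩ Z) ⟨Finset.inter_subset_right, Finset.subset_inter hY h.subset⟩
  have h2 : predim L (Y ∩ Z) ≤ predim L Y := h.selfSufficient.predim_le (fun m => by simp)
  omega

/-- A finite set that contains `X` and has predimension at most that of the closure `D` of `X` is
contained in `D`. -/
theorem IsClosure.subset_of_predim_le {X D Y : Finset M} (h : IsClosure L X D) (hY : X ⊆ Y)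
    (hYD : predim L Y ≤ predim L D) : Y ⊆ D := by
  by_contra hn
  obtain ⟨m, hm, hm'⟩ := Finset.not_subset.1 hn
  have h1 : predim L (Y ∩ D) < predim L Y :=
    h.selfSufficient.predim_lt (fun m => by simp) ⟨m, hm, hm'⟩
  have h2 := h.predim_le (Finset.subset_inter hY h.subset)
  omega

/-- The injective tuples that satisfy all the relations holding among the coordinates of `u` and
agree with `u` at the coordinates of `u` lying in `X` form an `X`-definable set. -/
theorem definable_positive_diagram (X : Set M) {n : ℕ} (u : Fin n → M) :
    X.Definable L {v : Fin n → M | (∀ i, u i ∈ X → v i = u i) ∧ (∀ i j, v i = v j → i = j) ∧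
      ∀ R : (Σ n, L.Relations n), ∀ t : Fin R.1 → Fin n, RelMap R.2 (u ∘ t) → RelMap R.2 (v ∘ t)} := by
  have h1 : X.Definable L {v : Fin n → M | ∀ i, u i ∈ X → v i = u i} := by
    rw [Set.ofPred_forall]
    refine Set.definable_iInter_of_finite fun i => ?_
    by_cases hi : u i ∈ X
    · simp only [hi, true_imp_iff]
      exact (Set.DefinableFun.proj L).ofPred_eq_const hi
    · simp [hi]
  have h2 : X.Definable L {v : Fin n → M | ∀ i j, v i = v j → i = j} := by
    simp only [Set.ofPred_forall]
    refine Set.definable_iInter_of_finite fun i => Set.definable_iInter_of_finite fun j => ?_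
    by_cases hij : i = j
    · simp [hij]
    · simp only [hij, imp_false]
      refine Set.Definable.compl (s := {v : Fin n → M | v i = v j}) ?_
      exact (Set.DefinableFun.proj L).ofPred_eq (Set.DefinableFun.proj L)
  have h3 : X.Definable L {v : Fin n → M | ∀ R : (Σ n, L.Relations n), ∀ t : Fin R.1 → Fin n,
      RelMap R.2 (u ∘ t) → RelMap R.2 (v ∘ t)} := by
    simp only [Set.ofPred_forall]
    refine Set.definable_iInter_of_finite fun R => Set.definable_iInter_of_finite fun t => ?_
    by_cases hR : RelMap R.2 (u ∘ t)
    · simp only [hR]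
      refine Set.Definable.mono (A := ∅) (Set.empty_definable_iff.2
        ⟨R.2.formula fun k => Term.var (t k), ?_⟩) (Set.empty_subset X)
      ext v
      simp [Formula.realize_rel, Function.comp_def]
    · simp [hR]
  exact (h1.inter (h2.inter h3) :)

/-- A tuple over `X` satisfying the positive diagram of `D` has a range of the same size with at
least as many facts, hence of predimension at most that of `D`, so it stays inside `D`. Thus the
diagram has finitely many solutions, and negated relations are not needed. -/
theorem IsClosure.subset_acl {X D : Finset M} (h : IsClosure L X D) :
    (D : Set M) ⊆ acl L (X : Set M) := by
  intro y hy
  set u : Fin D.card → M := fun i => D.equivFin.symm i with hu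
  have huD : ∀ m, m ∈ D ↔ ∃ i, u i = m := fun m =>
    ⟨fun hm => ⟨D.equivFin ⟨m, hm⟩, by simp [hu]⟩, by rintro ⟨i, rfl⟩; simp [hu]⟩
  have huinj : Function.Injective u := Subtype.val_injective.comp (Equiv.injective _)
  obtain ⟨i, hi⟩ := (huD y).1 hy
  have hdef := (definable_positive_diagram (L := L) (X : Set M) u).image_comp (fun _ : Fin 1 => i)
  set T := {v : Fin D.card → M | (∀ i, u i ∈ (X : Set M) → v i = u i) ∧ (∀ i j, v i = v j → i = j) ∧
      ∀ R : (Σ n, L.Relations n), ∀ t : Fin R.1 → Fin D.card,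
        RelMap R.2 (u ∘ t) → RelMap R.2 (v ∘ t)} with hT
  have hTD : ∀ v ∈ T, ∀ j, v j ∈ D := by
    rintro v ⟨hv1, hv2, hv3⟩ j
    have hvinj : Function.Injective v := hv2
    set Y : Finset M := Finset.univ.image v
    have hXY : X ⊆ Y := fun m hm => by
      obtain ⟨k, rfl⟩ := (huD m).1 (h.subset hm)
      exact Finset.mem_image.2 ⟨k, Finset.mem_univ _, hv1 k hm⟩
    refine h.subset_of_predim_le hXY ?_ (Finset.mem_image_of_mem v (Finset.mem_univ j))
    have hcard : Y.card = D.card := by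
      rw [Finset.card_image_of_injective _ hvinj]; simp
    -- The default index `i` only makes the map total; it is never used on points of `D`.
    have hD' : ∀ m : M, m ∈ D → u (if hm : m ∈ D then D.equivFin ⟨m, hm⟩ else i) = m := by
      intro m hm
      simp [hm, hu]
    set g : M → M := fun m => v (if hm : m ∈ D then D.equivFin ⟨m, hm⟩ else i) with hg
    have hgm : ∀ k, g (u k) = v k := fun k => by
      simp only [hg]
      congr 1
      exact huinj (hD' _ ((huD _).2 ⟨k, rfl⟩))
    have hfc : (facts L D).card ≤ (facts L Y).card := by
      refine Finset.card_le_card_of_injOn (Fact.map g) ?_ ?_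
      · rintro ⟨R, t⟩ hp
        rw [Finset.mem_coe, mem_facts] at hp
        rw [Finset.mem_coe, mem_facts]
        obtain ⟨t', rfl⟩ : ∃ t' : Fin R.1 → Fin D.card, u ∘ t' = t := by
          choose t' ht' using fun i => (huD _).1 (hp.2 i)
          exact ⟨t', funext ht'⟩
        have e : g ∘ (u ∘ t') = v ∘ t' := funext fun k => hgm _
        refine ⟨?_, fun k => ?_⟩
        · simp only [Fact.Holds, Fact.map, e]
          exact hv3 R t' hp.1
        · simp only [Fact.map, e]
          exact Finset.mem_image_of_mem v (Finset.mem_univ _)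
      · rintro ⟨R, t⟩ hp ⟨R', t'⟩ hp' he
        simp only [Fact.map, Sigma.mk.injEq] at he
        obtain ⟨rfl, he⟩ := he
        rw [Finset.mem_coe, mem_facts] at hp hp'
        congr 1
        funext k
        obtain ⟨a, ha⟩ := (huD _).1 (hp.2 k)
        obtain ⟨b, hb⟩ := (huD _).1 (hp'.2 k)
        have := congrFun (eq_of_heq he) k
        simp only [Function.comp] at ha hb this
        rw [← ha, ← hb, hgm, hgm] at this
        rw [← ha, ← hb, hvinj this]
    simp only [predim_eq]
    omega
  refine ⟨{x | (fun _ : Fin 1 => x) ∈ (fun v : Fin D.card → M => v ∘ fun _ : Fin 1 => i) '' T}, ?_, ?_, ?_⟩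
  · unfold Set.Definable₁
    convert hdef using 1
    ext z
    have : z = fun _ => z 0 := funext fun k => by rw [Subsingleton.elim k 0]
    simp only [Set.mem_ofPred_eq]
    rw [← this]
  · refine D.finite_toSet.subset ?_
    rintro x ⟨v, hv, hx⟩
    have := congrFun hx 0
    simp only [Function.comp] at this
    rw [← this]
    exact hTD v hv i
  · exact ⟨u, ⟨fun _ _ => rfl, fun _ _ h => huinj h, fun _ _ h => h⟩, by funext; simp [hi]⟩

end Closure

/-! ### Types of self-sufficient tuples in the generic structure -/

section BackAndForth

open Classical FirstOrder Language Structure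

variable {L : FirstOrder.Language.{v, w}} [Fintype (Σ n, L.Relations n)]
  {M : Type u} [L.Structure M] {f : ℝ → ℝ}

theorem memKf_of_embedding {N : Type*} [L.Structure N] [Finite N] (g : N ↪[L] M)
    (h₀ : SelfSufficient L (∅ : Set M)) (hf : ∀ X : Finset M, f X.card ≤ (predim L X : ℝ)) :
    MemKf L f N where
  finite := inferInstance
  empty_le := h₀.preimage g
  le_predim X := by
    have := hf (X.map g.toEmbedding)
    rwa [predim_map, Finset.card_map] at this

theorem IsGeneric.exists_finset_subset (hM : IsGeneric L f M) (X : Finset M) :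
    ∃ (S : L.Substructure M), MemKf L f S ∧ SelfSufficient L (S : Set M) ∧ (X : Set M) ⊆ S := by
  obtain ⟨S, hmono, hS, hcov⟩ := hM.exists_chain
  suffices h : ∃ i, (X : Set M) ⊆ S i by
    obtain ⟨i, hi⟩ := h
    exact ⟨S i, (hS i).1, (hS i).2, hi⟩
  choose i hi using hcov
  refine ⟨X.sup i, fun x hx => ?_⟩
  exact hmono (Finset.le_sup (f := i) hx) (hi x)

theorem IsGeneric.exists_selfSufficient (hM : IsGeneric L f M) (X : Finset M) :
    ∃ D : Finset M, SelfSufficient L (D : Set M) ∧ X ⊆ D := by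
  obtain ⟨S, hS, hS', hX⟩ := hM.exists_finset_subset X
  have hfin : (S : Set M).Finite := Set.finite_coe_iff.1 hS.finite
  refine ⟨hfin.toFinset, by simpa using hS', fun x hx => by simpa using hX hx⟩

theorem IsGeneric.exists_map_eq (hM : IsGeneric L f M) (X : Finset M) :
    ∃ (S : L.Substructure M) (X' : Finset S), MemKf L f S ∧
      X'.map S.subtype.toEmbedding = X := by
  obtain ⟨S, hS, -, hX⟩ := hM.exists_finset_subset X
  refine ⟨S, X.preimage S.subtype S.subtype.injective.injOn, hS, ?_⟩
  ext m
  simp only [Finset.mem_map, Finset.mem_preimage]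
  constructor
  · rintro ⟨n, hn, rfl⟩; exact hn
  · intro hm; exact ⟨⟨m, hX hm⟩, hm, rfl⟩

theorem IsGeneric.le_predim (hM : IsGeneric L f M) (X : Finset M) :
    f X.card ≤ (predim L X : ℝ) := by
  obtain ⟨S, X', hS, rfl⟩ := hM.exists_map_eq X
  rw [predim_map, Finset.card_map]
  exact hS.le_predim X'

theorem IsGeneric.empty_selfSufficient (hM : IsGeneric L f M) :
    SelfSufficient L (∅ : Set M) := by
  refine selfSufficient_iff.2 fun X Z hZ hX => ?_
  obtain ⟨S, X', hS, rfl⟩ := hM.exists_map_eq X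
  have hZ' : Z = (∅ : Finset S).map S.subtype.toEmbedding := by
    ext m; simp [hZ]
  rw [hZ', predim_map, predim_map]
  refine hS.empty_le.predim_lt (by simp) ?_
  obtain ⟨m, hm, -⟩ := hX
  obtain ⟨n, hn, -⟩ := Finset.mem_map.1 hm
  exact ⟨n, hn, fun h => h⟩

/-- The tuples `u` and `u'` enumerate self-sufficient sets and the correspondence between their
coordinates is an isomorphism. -/
structure Similar (L : FirstOrder.Language.{v, w}) [Fintype (Σ n, L.Relations n)]
    [L.Structure M] {κ : Type*} (u u' : κ → M) : Prop where
  eq_iff : ∀ i j, u i = u j ↔ u' i = u' j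
  rel_iff : ∀ R : (Σ n, L.Relations n), ∀ t : Fin R.1 → κ,
    RelMap R.2 (u ∘ t) ↔ RelMap R.2 (u' ∘ t)
  left : SelfSufficient L (Set.range u)
  right : SelfSufficient L (Set.range u')

theorem Similar.symm {κ : Type*} {u u' : κ → M} (h : Similar L u u') : Similar L u' u :=
  ⟨fun i j => (h.eq_iff i j).symm, fun R t => (h.rel_iff R t).symm, h.right, h.left⟩

variable [L.IsRelational]

/-- Every subset of a structure in a relational language is a substructure. -/
def substructureOf (L : FirstOrder.Language.{v, w}) [L.IsRelational] [L.Structure M] (s : Set M) :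
    L.Substructure M where
  carrier := s
  fun_mem g := isEmptyElim g

/-- The extension property for a partial isomorphism given by two tuples, possibly with repetitions.
-/
theorem IsGeneric.exists_extension (hM : IsGeneric L f M) {κ : Type*} [Finite κ]
    {N : Type u} [L.Structure N] (hN : MemKf L f N) {u : κ → N} {u' : κ → M}
    (heq : ∀ i j, u i = u j ↔ u' i = u' j)
    (hrel : ∀ R : (Σ n, L.Relations n), ∀ t : Fin R.1 → κ,
      RelMap R.2 (u ∘ t) ↔ RelMap R.2 (u' ∘ t))
    (hu : SelfSufficient L (Set.range u)) (hu' : SelfSufficient L (Set.range u')) :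
    ∃ β : N ↪[L] M, SelfSufficient L (Set.range β) ∧ ∀ k, β (u k) = u' k := by
  set A : L.Substructure M := substructureOf L (Set.range u') with hA
  have hmem : ∀ x : A, ∃ k, u' k = x := fun x => x.2
  choose ch hch using hmem
  let i : A ↪[L] N :=
    { toFun := fun x => u (ch x)
      inj' := fun x y hxy => by
        have := (heq _ _).1 hxy
        rw [hch, hch] at this
        exact Subtype.ext this
      map_fun' := fun g => isEmptyElim g
      map_rel' := fun {n} R x => by
        have h1 := hrel ⟨n, R⟩ (ch ∘ x)
        have h2 : u' ∘ (ch ∘ x) = fun k => (x k : M) := funext fun k => hch (x k)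
        rw [h2] at h1
        exact h1 }
  have hi : ∀ k, i ⟨u' k, k, rfl⟩ = u k := fun k => (heq _ _).2 (hch _)
  have hir : Set.range i = Set.range u := by
    ext n
    constructor
    · rintro ⟨x, rfl⟩; exact ⟨_, rfl⟩
    · rintro ⟨k, rfl⟩; exact ⟨_, hi k⟩
  have hfin : Finite A := (Set.finite_range u').to_subtype
  obtain ⟨β, h1, h2⟩ := hM.extension A hfin hu' N hN i (by rw [hir]; exact hu)
  exact ⟨β, h1, fun k => by rw [← hi k, h2]⟩

/-- The forth step: `D` itself is a member of the class, so it can be re-embedded over `u'`. -/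
theorem IsGeneric.exists_similar (hM : IsGeneric L f M) {κ : Type*} [Finite κ]
    {u u' : κ → M} (h : Similar L u u') {D : Finset M} (hD : SelfSufficient L (D : Set M))
    (huD : ∀ k, u k ∈ D) :
    ∃ β : D → M, Similar L (fun d : D => (d : M)) β ∧ ∀ k, β ⟨u k, huD k⟩ = u' k := by
  set B : L.Substructure M := substructureOf L (D : Set M)
  have : Finite B := D.finite_toSet.to_subtype
  have hB : MemKf L f B := memKf_of_embedding B.subtype hM.empty_selfSufficient hM.le_predim
  have hBr : Set.range B.subtype = (D : Set M) := Subtype.range_coe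
  have hu : SelfSufficient L (Set.range fun k => (⟨u k, huD k⟩ : B)) := by
    have := h.left.preimage B.subtype
    convert this using 1
    ext x
    constructor
    · rintro ⟨k, rfl⟩; exact ⟨k, rfl⟩
    · rintro ⟨k, hk⟩; exact ⟨k, Subtype.ext hk⟩
  obtain ⟨β, h1, h2⟩ := hM.exists_extension hB (u := fun k => (⟨u k, huD k⟩ : B))
    (u' := u') (fun i j => Subtype.ext_iff.trans (h.eq_iff i j)) (fun R t => h.rel_iff R t) hu h.right
  refine ⟨β, ⟨fun i j => ?_, fun R t => (β.map_rel R.2 t).symm, ?_, h1⟩, h2⟩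
  · exact (Subtype.coe_injective.eq_iff).trans β.injective.eq_iff.symm
  · rw [← hBr] at hD; exact hD

/-- Back-and-forth by induction on the formula. The index type varies because a quantifier enlarges
the tuple to an enumeration of a finite self-sufficient set `D`, which is its own index type; hence
`κ : Type u`. -/
theorem IsGeneric.realize_iff (hM : IsGeneric L f M) {α : Type*} {n : ℕ}
    (φ : L.BoundedFormula α n) :
    ∀ (κ : Type u) [Finite κ] (u u' : κ → M), Similar L u u' → ∀ (s : α → κ) (t : Fin n → κ),
      φ.Realize (u ∘ s) (u ∘ t) ↔ φ.Realize (u' ∘ s) (u' ∘ t) := by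
  have hvar : ∀ {n : ℕ} (x : L.Term (α ⊕ Fin n)), ∃ y, x = Term.var y := fun x => by
    cases x with
    | var y => exact ⟨y, rfl⟩
    | func g _ => exact isEmptyElim g
  have hreal : ∀ {n : ℕ} {κ : Type u} (u : κ → M) (s : α → κ) (t : Fin n → κ) (y : α ⊕ Fin n),
      (Sum.elim (u ∘ s) (u ∘ t)) y = u (Sum.elim s t y) := by
    rintro n κ u s t (y | y) <;> rfl
  induction φ with
  | falsum => intros; exact Iff.rfl
  | equal x y =>
    intro κ _ u u' h s t
    obtain ⟨x, rfl⟩ := hvar x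
    obtain ⟨y, rfl⟩ := hvar y
    simp only [BoundedFormula.Realize, Term.realize_var, hreal]
    exact h.eq_iff _ _
  | rel R x =>
    intro κ _ u u' h s t
    choose y hy using fun i => hvar (x i)
    obtain rfl : x = fun i => Term.var (y i) := funext hy
    simp only [BoundedFormula.Realize, Term.realize_var, hreal]
    exact h.rel_iff ⟨_, R⟩ fun i => Sum.elim s t (y i)
  | imp φ ψ h1 h2 =>
    intro κ _ u u' h s t
    simp only [BoundedFormula.realize_imp, h1 κ u u' h s t, h2 κ u u' h s t]
  | all φ ih =>
    -- Similarity is symmetric, so one direction suffices.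
    have key : ∀ (κ : Type u) [Finite κ] (u u' : κ → M), Similar L u u' →
        ∀ (s : α → κ) (t : Fin _ → κ), φ.all.Realize (u' ∘ s) (u' ∘ t) →
          φ.all.Realize (u ∘ s) (u ∘ t) := by
      intro κ _ u u' h s t hr
      rw [BoundedFormula.realize_all] at hr ⊢
      intro m
      have := Fintype.ofFinite κ
      obtain ⟨D, hD, hsub⟩ := hM.exists_selfSufficient (insert m (Finset.univ.image u))
      have huD : ∀ k, u k ∈ D := fun k =>
        hsub (Finset.mem_insert_of_mem (Finset.mem_image_of_mem u (Finset.mem_univ k)))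
      obtain ⟨β, hβ, hβu⟩ := hM.exists_similar h hD huD
      set m' : D := ⟨m, hsub (Finset.mem_insert_self _ _)⟩
      have := (ih D _ _ hβ (fun a => ⟨u (s a), huD _⟩)
        (Fin.snoc (fun a => ⟨u (t a), huD _⟩) m')).2
      have e1 : (β ∘ fun a => ⟨u (s a), huD _⟩) = u' ∘ s := funext fun a => hβu _
      have e2 : (β ∘ (Fin.snoc (fun a => ⟨u (t a), huD _⟩) m' : Fin _ → D)) =
          (Fin.snoc (u' ∘ t) (β m') : Fin _ → M) := by
        rw [Fin.comp_snoc]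
        congr 1
        exact funext fun a => hβu _
      have e3 : ((fun d : D => (d : M)) ∘ (Fin.snoc (fun a => ⟨u (t a), huD _⟩) m' : Fin _ → D)) =
          (Fin.snoc (u ∘ t) m : Fin _ → M) := by
        rw [Fin.comp_snoc]
        rfl
      rw [e1, e2, e3] at this
      exact this (hr _)
    intro κ _ u u' h s t
    exact ⟨key κ u' u h.symm s t, key κ u u' h s t⟩

/-- Parameters from `A` are coordinates fixed by the correspondence, so a formula over `A` becomes a
parameter-free formula about the whole tuple. -/
theorem IsGeneric.mem_loc (hM : IsGeneric L f M) {κ : Type u} [Finite κ] {u u' : κ → M}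
    (h : Similar L u u') {A : Set M} (hA : ∀ a ∈ A, ∃ k, u k = a ∧ u' k = a) (k : κ) :
    u' k ∈ loc L A (u k) := by
  intro φ hφ
  have hdef : A.Definable L {v : Unit → M | φ.Realize v} := ⟨φ, rfl⟩
  obtain ⟨ψ, hψ⟩ := Set.definable_iff_exists_formula_sum.1 hdef
  have hψ' : ∀ v : Unit → M, φ.Realize v ↔ ψ.Realize (Sum.elim (fun a : A => (a : M)) v) :=
    fun v => Set.ext_iff.1 hψ v
  choose c hc hc' using fun a : A => hA a a.2
  have e : ∀ w : κ → M, (∀ a, w (c a) = a) →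
      Sum.elim (fun a : A => (a : M)) (fun _ : Unit => w k) = w ∘ Sum.elim c (fun _ => k) := by
    intro w hw
    funext x
    rcases x with x | x
    · exact (hw x).symm
    · rfl
  have hφ' : φ.Realize (fun _ : Unit => u k) := hφ
  rw [hψ', e u hc] at hφ'
  rw [hψ', e u' hc']
  have := hM.realize_iff ψ κ u u' h (Sum.elim c fun _ => k) (fun i => i.elim0)
  unfold Formula.Realize at hφ' ⊢
  convert this.1 (by convert hφ')

end BackAndForth

/-! ### Growth of the control function -/

section Growth

variable {f f' : ℝ → ℝ}

/-- From `n` on the slope is at most `1 / (2 * (n + 1))`, so `f` stays below the line with that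
slope. -/
theorem IsGood.map_add_le (hf : IsGood f f') (hf' : ∀ x, 0 ≤ x → f' x ≤ 1 / (2 * (x + 1)))
    (n k : ℕ) : f (n + k : ℕ) ≤ f n + k / (2 * (n + 1)) := by
  have hn : (0 : ℝ) ≤ n := n.cast_nonneg
  have hc : ∀ x : ℝ, HasDerivWithinAt (fun x : ℝ => f n + (x - n) * (1 / (2 * (n + 1))))
      (1 / (2 * (n + 1))) (Set.Ici x) x := fun x => by
    have := (((hasDerivAt_id x).sub_const (n : ℝ)).mul_const (1 / (2 * ((n : ℝ) + 1)))).const_add (f n)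
    simpa using this.hasDerivWithinAt
  have := image_le_of_deriv_right_le_deriv_boundary (f := f) (f' := f') (a := n) (b := n + k)
    (hf.continuousOn.mono fun x hx => hn.trans hx.1)
    (fun x hx => (hf.hasDerivWithinAt x (hn.trans hx.1)).Ici_of_Ioi)
    (B := fun x => f n + (x - n) * (1 / (2 * (n + 1)))) (B' := fun _ => 1 / (2 * (n + 1)))
    (by simp) (by fun_prop) (fun x _ => hc x)
    (fun x hx => (hf' x (hn.trans hx.1)).trans
      (one_div_le_one_div_of_le (by positivity) (by linarith [hx.1])))
    (x := n + k) ⟨by simp, le_rfl⟩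
  push_cast
  refine this.trans (le_of_eq ?_)
  ring

theorem IsGood.map_natCast_mono (hf : IsGood f f') {m n : ℕ} (h : m ≤ n) : f m ≤ f n :=
  hf.monotoneOn (Set.mem_Ici.2 m.cast_nonneg) (Set.mem_Ici.2 n.cast_nonneg) (by exact_mod_cast h)

theorem IsGood.map_add_le_of_le (hf : IsGood f f') (hf' : ∀ x, 0 ≤ x → f' x ≤ 1 / (2 * (x + 1)))
    {n k : ℕ} {c : ℕ} (h : k ≤ 2 * (n + 1) * c) : f (n + k : ℕ) ≤ f n + c := by
  refine (hf.map_add_le hf' n k).trans ?_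
  gcongr
  rw [div_le_iff₀ (by positivity)]
  have : (k : ℝ) ≤ 2 * (n + 1) * c := by exact_mod_cast h
  linarith

/-- The growth estimate behind the amalgamation of one set of size `n` with `s` sets of size at
most `m`. -/
theorem IsGood.map_add_mul_le (hf : IsGood f f') (hf' : ∀ x, 0 ≤ x → f' x ≤ 1 / (2 * (x + 1)))
    {n m s : ℕ} (hs : 2 ≤ s) {d : ℝ} (hn : f n + 1 ≤ d) (hm : f m + (s - 1 : ℕ) ≤ d) :
    f (n + s * m : ℕ) ≤ d := by
  by_cases h : s * m ≤ 2 * (n + 1)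
  · have := hf.map_add_le_of_le hf' (n := n) (k := s * m) (c := 1) (by simpa using h)
    push_cast at this
    push_cast
    linarith
  · obtain ⟨s, rfl⟩ := Nat.exists_eq_add_of_le' hs
    have e : n + (s + 2) * m = m + (n + (s + 1) * m) := by ring
    rw [e]
    refine (hf.map_add_le_of_le hf' (c := s + 1) ?_).trans hm
    nlinarith [Nat.zero_le (s * m)]

/-- Grow from the larger of the two sizes: at most doubling it costs at most 1. -/
theorem IsGood.map_add_le_of_le_of_le (hf : IsGood f f')
    (hf' : ∀ x, 0 ≤ x → f' x ≤ 1 / (2 * (x + 1)))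
    {n m : ℕ} {d : ℝ} (hn : f n + 1 ≤ d) (hm : f m + 1 ≤ d) : f (n + m : ℕ) ≤ d := by
  rcases le_total m n with h | h
  · have := hf.map_add_le_of_le hf' (n := n) (k := m) (c := 1) (by omega)
    push_cast at this ⊢
    linarith
  · have := hf.map_add_le_of_le hf' (n := m) (k := n) (c := 1) (by omega)
    rw [add_comm]
    push_cast at this ⊢
    linarith

end Growth

/-! ### The linked amalgam -/

section Amalgam

open Classical FirstOrder Language Structure

variable {L : FirstOrder.Language.{v, w}} {M : Type u}

/-- The underlying set of the free amalgam over `A` of `M` (the base) with copies of `M` indexed by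
`Option J`. The last two arguments only serve to select the structure it carries, in which the
copies of `b` are linked to the points of `J` in the base by the ternary relation `R₀`. -/
@[nolint unusedArguments]
def Amalgam (A J : Finset M) (_ : M) (_ : L.Relations 3) : Type u :=
  M ⊕ (Option J × {m : M // m ∉ A})

namespace Amalgam

variable {A J : Finset M} {b : M} {R₀ : L.Relations 3}

/-- The inclusion of the base. -/
def base (m : M) : Amalgam A J b R₀ := Sum.inl m

/-- The inclusion of the copy with index `i`. -/
noncomputable def copy (i : Option J) (m : M) : Amalgam A J b R₀ :=
  if h : m ∈ A then Sum.inl m else Sum.inr (i, ⟨m, h⟩)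

/-- The projection to `M` that identifies all the copies with the base. -/
def proj : Amalgam A J b R₀ → M := Sum.elim id fun p => p.2

/-- The fact that links the central copy of `b`, the copy of `b` with index `j`, and `j`. -/
noncomputable def link (j : J) : Fact L (Amalgam A J b R₀) :=
  ⟨⟨3, R₀⟩, ![copy none b, copy (some j) b, base j]⟩

@[simp] theorem proj_base (m : M) : proj (base m : Amalgam A J b R₀) = m := rfl

theorem copy_of_mem (i : Option J) {m : M} (h : m ∈ A) :
    (copy i m : Amalgam A J b R₀) = base m :=
  dif_pos h

theorem copy_of_notMem (i : Option J) {m : M} (h : m ∉ A) :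
    (copy i m : Amalgam A J b R₀) = (Sum.inr (i, ⟨m, h⟩) : M ⊕ (Option J × {m : M // m ∉ A})) :=
  dif_neg h

@[simp] theorem proj_copy (i : Option J) (m : M) : proj (copy i m : Amalgam A J b R₀) = m := by
  by_cases h : m ∈ A
  · rw [copy_of_mem i h]; rfl
  · rw [copy_of_notMem i h]; rfl

theorem copy_eq_base {i : Option J} {m m' : M} :
    (copy i m : Amalgam A J b R₀) = base m' ↔ m = m' ∧ m ∈ A := by
  constructor
  · intro h
    have h1 : m = m' := by simpa using congrArg proj h
    refine ⟨h1, by_contra fun hm => ?_⟩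
    rw [copy_of_notMem i hm] at h
    cases h
  · rintro ⟨rfl, h⟩; exact copy_of_mem i h

theorem copy_eq_copy {i i' : Option J} {m m' : M} :
    (copy i m : Amalgam A J b R₀) = copy i' m' ↔ m = m' ∧ (m ∈ A ∨ i = i') := by
  constructor
  · intro h
    have h1 : m = m' := by simpa using congrArg proj h
    subst h1
    refine ⟨rfl, or_iff_not_imp_left.2 fun hm => ?_⟩
    rw [copy_of_notMem i hm, copy_of_notMem i' hm] at h
    exact congrArg Prod.fst (Sum.inr.inj h)
  · rintro ⟨rfl, h | rfl⟩
    · rw [copy_of_mem _ h, copy_of_mem _ h]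
    · rfl

theorem base_injective : Function.Injective (base : M → Amalgam A J b R₀) :=
  Function.LeftInverse.injective proj_base

theorem copy_injective (i : Option J) : Function.Injective (copy i : M → Amalgam A J b R₀) :=
  Function.LeftInverse.injective (proj_copy i)

theorem base_or_copy (w : Amalgam A J b R₀) :
    (∃ m, w = base m) ∨ ∃ i, ∃ m ∉ A, w = copy i m := by
  rcases w with m | ⟨i, m, hm⟩
  · exact Or.inl ⟨m, rfl⟩
  · exact Or.inr ⟨i, m, hm, (copy_of_notMem i hm).symm⟩

/-- Stated for an arbitrary fact `p` so that it applies when the arity is a variable rather than the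
literal 3. -/
theorem exists_coord_of_link_eq {p : Fact L (Amalgam A J b R₀)} {j : J} (h : link j = p) :
    (∃ k, p.2 k = copy none b) ∧ ∃ k, p.2 k = copy (some j) b := by
  subst h
  exact ⟨⟨(0 : Fin 3), rfl⟩, ⟨(1 : Fin 3), rfl⟩⟩

/-- The part of `X` in the base. -/
noncomputable def basePart (X : Finset (Amalgam A J b R₀)) : Finset M :=
  X.preimage base base_injective.injOn

/-- The part of `X` in the copy with index `i`. -/
noncomputable def copyPart (X : Finset (Amalgam A J b R₀)) (i : Option J) : Finset M :=
  X.preimage (copy i) (copy_injective i).injOn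

/-- The indices of the copies that `X` meets outside `A`. -/
noncomputable def indices (X : Finset (Amalgam A J b R₀)) : Finset (Option J) :=
  Finset.univ.filter fun i => ∃ m ∈ copyPart X i, m ∉ A

/-- The points of `J` whose link is contained in `X`. -/
noncomputable def links (X : Finset (Amalgam A J b R₀)) : Finset J :=
  Finset.univ.filter fun j => ∀ k, (link j).2 k ∈ X

variable {X : Finset (Amalgam A J b R₀)}

@[simp] theorem mem_basePart {m : M} : m ∈ basePart X ↔ base m ∈ X := by simp [basePart]

@[simp] theorem mem_copyPart {i : Option J} {m : M} : m ∈ copyPart X i ↔ copy i m ∈ X := by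
  simp [copyPart]

theorem mem_links {j : J} :
    j ∈ links X ↔ copy none b ∈ X ∧ copy (some j) b ∈ X ∧ base (j : M) ∈ X := by
  simp only [links, Finset.mem_filter, Finset.mem_univ, true_and]
  exact Fin.forall_fin_succ.trans (and_congr Iff.rfl Fin.forall_fin_two)

theorem copyPart_inter (i : Option J) : copyPart X i ∩ A = basePart X ∩ A := by
  ext m
  simp only [Finset.mem_inter, mem_copyPart, mem_basePart]
  refine and_congr_left fun h => ?_
  rw [copy_of_mem i h]

theorem basePart_inter_subset (i : Option J) : basePart X ∩ A ⊆ copyPart X i := by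
  rw [← copyPart_inter i]; exact Finset.inter_subset_left

theorem copyPart_eq_of_notMem {i : Option J} (h : i ∉ indices X) :
    copyPart X i = basePart X ∩ A := by
  rw [← copyPart_inter i, eq_comm, Finset.inter_eq_left]
  intro m hm
  by_contra hA
  exact h (Finset.mem_filter.2 ⟨Finset.mem_univ _, m, hm, hA⟩)

theorem card_eq (X : Finset (Amalgam A J b R₀)) : (X.card : ℤ) =
    (basePart X).card + ∑ i, (((copyPart X i).card : ℤ) - (basePart X ∩ A).card) := by
  have h1 : X = (basePart X).map ⟨base, base_injective⟩ ∪ Finset.univ.biUnion fun i =>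
      (copyPart X i \ (basePart X ∩ A)).map ⟨copy i, copy_injective i⟩ := by
    ext w
    simp only [Finset.mem_union, Finset.mem_map, Finset.mem_biUnion, Finset.mem_univ, true_and,
      Finset.mem_sdiff, Finset.mem_inter, mem_basePart, mem_copyPart, Function.Embedding.coeFn_mk]
    constructor
    · intro hw
      rcases base_or_copy w with ⟨m, rfl⟩ | ⟨i, m, hm, rfl⟩
      · exact Or.inl ⟨m, hw, rfl⟩
      · exact Or.inr ⟨i, m, ⟨hw, fun h => hm h.2⟩, rfl⟩
    · rintro (⟨m, hm, rfl⟩ | ⟨i, m, ⟨hm, -⟩, rfl⟩)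
      · exact hm
      · exact hm
  have hnA : ∀ i, ∀ m ∈ copyPart X i \ (basePart X ∩ A), m ∉ A := fun i m hm hA => by
    rw [← copyPart_inter i, Finset.mem_sdiff, Finset.mem_inter] at hm
    exact hm.2 ⟨hm.1, hA⟩
  have h2 := congrArg Finset.card h1
  rw [Finset.card_union_of_disjoint, Finset.card_biUnion, Finset.card_map] at h2
  · rw [h2]
    push_cast
    congr 1
    refine Finset.sum_congr rfl fun i _ => ?_
    rw [Finset.card_map, Finset.card_sdiff_of_subset (basePart_inter_subset i),
      Nat.cast_sub (Finset.card_le_card (basePart_inter_subset i))]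
  · intro i _ i' _ hne
    refine Finset.disjoint_left.2 fun w hw hw' => ?_
    obtain ⟨m, hm, rfl⟩ := Finset.mem_map.1 hw
    obtain ⟨m', hm', e⟩ := Finset.mem_map.1 hw'
    obtain ⟨rfl, h⟩ := copy_eq_copy.1 e
    exact hne (h.resolve_left (hnA _ _ hm')).symm
  · rw [Finset.disjoint_left]
    intro w hw hw'
    obtain ⟨i, -, hw'⟩ := Finset.mem_biUnion.1 hw'
    obtain ⟨m, hm, rfl⟩ := Finset.mem_map.1 hw
    obtain ⟨m', hm', e⟩ := Finset.mem_map.1 hw'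
    exact hnA _ _ hm' (copy_eq_base.1 e).2

/-- A link for `j` needs the copy with index `j` and also the central one, and the latter is not the
index of any link. -/
theorem card_links_lt (hb : b ∉ A) (h : (indices X).Nonempty) :
    (links X).card < (indices X).card := by
  rcases (links X).eq_empty_or_nonempty with he | ⟨j, hj⟩
  · rw [he]; simpa using h
  · have hnone : none ∈ indices X := by
      simp only [indices, Finset.mem_filter, Finset.mem_univ, true_and]
      exact ⟨b, mem_copyPart.2 (mem_links.1 hj).1, hb⟩
    rw [← Finset.card_map Function.Embedding.some]
    refine Finset.card_lt_card (Finset.ssubset_iff_subset_ne.2 ⟨fun i hi => ?_, fun he => ?_⟩)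
    · obtain ⟨j, hj, rfl⟩ := Finset.mem_map.1 hi
      simp only [indices, Finset.mem_filter, Finset.mem_univ, true_and]
      exact ⟨b, mem_copyPart.2 (mem_links.1 hj).2.1, hb⟩
    · rw [← he] at hnone
      simp at hnone

theorem card_links_le : (links X).card ≤ (basePart X ∩ J).card := by
  rw [← Finset.card_map (Function.Embedding.subtype (· ∈ J))]
  refine Finset.card_le_card fun m hm => ?_
  obtain ⟨j, hj, rfl⟩ := Finset.mem_map.1 hm
  exact Finset.mem_inter.2 ⟨mem_basePart.2 (mem_links.1 hj).2.2, j.2⟩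

theorem sum_eq_sum_indices (X : Finset (Amalgam A J b R₀)) (g : Finset M → ℤ) :
    ∑ i, (g (copyPart X i) - g (basePart X ∩ A)) =
      ∑ i ∈ indices X, (g (copyPart X i) - g (basePart X ∩ A)) := by
  refine (Finset.sum_subset (Finset.subset_univ _) fun i _ hi => ?_).symm
  rw [copyPart_eq_of_notMem hi, sub_self]

variable [L.IsRelational] [L.Structure M]

noncomputable instance : L.Structure (Amalgam A J b R₀) where
  funMap g := isEmptyElim g
  RelMap {n} R t := (∃ t', RelMap R t' ∧ base ∘ t' = t) ∨ (∃ i t', RelMap R t' ∧ copy i ∘ t' = t) ∨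
    ∃ j, link j = (⟨⟨n, R⟩, t⟩ : Fact L (Amalgam A J b R₀))

theorem relMap_iff {n : ℕ} {R : L.Relations n} {t : Fin n → Amalgam A J b R₀} :
    RelMap R t ↔ (∃ t', RelMap R t' ∧ base ∘ t' = t) ∨ (∃ i t', RelMap R t' ∧ copy i ∘ t' = t) ∨
    ∃ j, link j = (⟨⟨n, R⟩, t⟩ : Fact L (Amalgam A J b R₀)) := Iff.rfl

/-- The base of the amalgam, as an embedding. -/
def baseEmb (hb : b ∉ A) : M ↪[L] Amalgam A J b R₀ where
  toFun := base
  inj' := base_injective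
  map_fun' g := isEmptyElim g
  map_rel' {n} R x := by
    refine ⟨fun h => ?_, fun h => Or.inl ⟨x, h, rfl⟩⟩
    rcases relMap_iff.1 h with ⟨t', h, e⟩ | ⟨i, t', h, e⟩ | ⟨j, e⟩
    · rwa [← base_injective.comp_left e]
    · have : t' = x := funext fun k => (copy_eq_base.1 (congrFun e k)).1
      rwa [← this]
    · obtain ⟨⟨k, hk⟩, -⟩ := exists_coord_of_link_eq e
      exact absurd (copy_eq_base.1 hk.symm).2 hb

/-- The copies inside the amalgam, as embeddings. -/
noncomputable def copyEmb (hb : b ∉ A) (i : Option J) : M ↪[L] Amalgam A J b R₀ where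
  toFun := copy i
  inj' := copy_injective i
  map_fun' g := isEmptyElim g
  map_rel' {n} R x := by
    refine ⟨fun h => ?_, fun h => Or.inr (Or.inl ⟨i, x, h, rfl⟩)⟩
    rcases relMap_iff.1 h with ⟨t', h, e⟩ | ⟨i, t', h, e⟩ | ⟨j, e⟩
    · have : x = t' := funext fun k => (copy_eq_base.1 (congrFun e k).symm).1
      rwa [this]
    · have : t' = x := funext fun k => (copy_eq_copy.1 (congrFun e k)).1
      rwa [← this]
    -- A link meets two different copies outside `A`, so it lies in neither.
    · obtain ⟨⟨k, hk⟩, ⟨k', hk'⟩⟩ := exists_coord_of_link_eq e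
      have h1 := (copy_eq_copy.1 hk)
      have h2 := (copy_eq_copy.1 hk')
      rw [h1.1] at h1
      rw [h2.1] at h2
      have h3 := (h1.2.resolve_left hb).symm.trans (h2.2.resolve_left hb)
      cases h3

theorem eq_map_of_indices_eq_empty (hb : b ∉ A) (h : indices X = ∅) :
    X = (basePart X).map (baseEmb (L := L) hb).toEmbedding := by
  ext w
  simp only [Finset.mem_map, mem_basePart]
  constructor
  · intro hw
    rcases base_or_copy w with ⟨m, rfl⟩ | ⟨i, m, hm, rfl⟩
    · exact ⟨m, hw, rfl⟩
    · have : i ∈ indices X := by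
        simp only [indices, Finset.mem_filter, Finset.mem_univ, true_and]
        exact ⟨m, mem_copyPart.2 hw, hm⟩
      simp [h] at this
  · rintro ⟨m, hm, rfl⟩
    exact hm

/-! ### Predimension in the amalgam -/

variable [Fintype (Σ n, L.Relations n)]

/-- A fact comes from the base, from a copy, or is a link; those inside `A` are counted only with
the base. -/
theorem card_facts_le (X : Finset (Amalgam A J b R₀)) : ((facts L X).card : ℤ) ≤
    (facts L (basePart X)).card +
      ∑ i, (((facts L (copyPart X i)).card : ℤ) - (facts L (basePart X ∩ A)).card) +
      (links X).card := by
  have h1 : facts L X ⊆ ((facts L (basePart X)).image (Fact.map base) ∪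
      Finset.univ.biUnion fun i =>
        (facts L (copyPart X i) \ facts L (basePart X ∩ A)).image (Fact.map (copy i))) ∪
      (links X).image link := by
    rintro ⟨⟨n, R⟩, t⟩ hp
    obtain ⟨hR, ht⟩ := mem_facts.1 hp
    simp only [Finset.mem_union, Finset.mem_image, Finset.mem_biUnion, Finset.mem_univ, true_and,
      Finset.mem_sdiff]
    rcases (relMap_iff (n := n) (R := R) (t := t)).1 hR with ⟨t', h, rfl⟩ | ⟨i, t', h, rfl⟩ | ⟨j, e⟩
    · exact Or.inl (Or.inl ⟨⟨⟨n, R⟩, t'⟩, mem_facts.2 ⟨h, fun k => mem_basePart.2 (ht k)⟩, rfl⟩)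
    · by_cases hA : (⟨⟨n, R⟩, t'⟩ : Fact L M) ∈ facts L (basePart X ∩ A)
      · refine Or.inl (Or.inl ⟨⟨⟨n, R⟩, t'⟩, facts_mono Finset.inter_subset_left hA, ?_⟩)
        have : (base ∘ t' : Fin n → Amalgam A J b R₀) = copy i ∘ t' := funext fun k =>
          (copy_of_mem i (Finset.mem_inter.1 ((mem_facts.1 hA).2 k)).2).symm
        simp only [Fact.map, this]
      · exact Or.inl (Or.inr ⟨i, ⟨⟨n, R⟩, t'⟩, ⟨mem_facts.2 ⟨h, fun k => mem_copyPart.2 (ht k)⟩, hA⟩,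
          rfl⟩)
    · refine Or.inr ⟨j, ?_, e⟩
      -- The fact is generalized so that the equation with `link j` can be substituted.
      have hall : ∀ p : Fact L (Amalgam A J b R₀), link j = p → (∀ k, p.2 k ∈ X) → j ∈ links X := by
        rintro _ rfl h
        simpa [links] using h
      exact hall _ e ht
  have h2 := (Finset.card_le_card h1).trans (Finset.card_union_le _ _)
  have h3 := Finset.card_union_le ((facts L (basePart X)).image (Fact.map base))
    (Finset.univ.biUnion fun i =>
        (facts L (copyPart X i) \ facts L (basePart X ∩ A)).image
          (Fact.map (copy i : M → Amalgam A J b R₀)))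
  have h4 : (Finset.univ.biUnion fun i =>
        (facts L (copyPart X i) \ facts L (basePart X ∩ A)).image
          (Fact.map (copy i : M → Amalgam A J b R₀))).card ≤
      ∑ i, (facts L (copyPart X i) \ facts L (basePart X ∩ A)).card :=
    Finset.card_biUnion_le.trans (Finset.sum_le_sum fun i _ => Finset.card_image_le)
  have h5 : ((∑ i, (facts L (copyPart X i) \ facts L (basePart X ∩ A)).card : ℕ) : ℤ) =
      ∑ i, (((facts L (copyPart X i)).card : ℤ) - (facts L (basePart X ∩ A)).card) := by
    push_cast
    refine Finset.sum_congr rfl fun i _ => ?_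
    have := facts_mono (L := L) (basePart_inter_subset (X := X) i)
    rw [Finset.card_sdiff_of_subset this, Nat.cast_sub (Finset.card_le_card this)]
  have h6 := Finset.card_image_le (s := links X) (f := (link : J → Fact L (Amalgam A J b R₀)))
  have h7 := Finset.card_image_le (s := facts L (basePart X))
    (f := Fact.map (base : M → Amalgam A J b R₀))
  omega

theorem le_predim_sum (X : Finset (Amalgam A J b R₀)) :
    predim L (basePart X) + ∑ i, (predim L (copyPart X i) - predim L (basePart X ∩ A)) -
      (links X).card ≤ predim L X := by
  have h1 := card_eq X
  have h2 := card_facts_le X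
  have h3 : ∑ i, (predim L (copyPart X i) - predim L (basePart X ∩ A)) =
      ∑ i, (((copyPart X i).card : ℤ) - (basePart X ∩ A).card) -
      ∑ i, (((facts L (copyPart X i)).card : ℤ) - (facts L (basePart X ∩ A)).card) := by
    rw [← Finset.sum_sub_distrib]
    refine Finset.sum_congr rfl fun i _ => ?_
    simp only [predim_eq]
    ring
  rw [h3, predim_eq, predim_eq]
  omega

omit [L.IsRelational] in
theorem predim_lt_copyPart (hA : SelfSufficient L (A : Set M)) {i : Option J}
    (hi : i ∈ indices X) : predim L (basePart X ∩ A) < predim L (copyPart X i) := by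
  refine hA.predim_lt (fun m => ?_) (by simpa [indices] using hi)
  rw [← copyPart_inter i]
  simp

/-- Each copy met outside `A` contributes at least 1, and there are fewer links than such copies. -/
theorem predim_basePart_lt (hb : b ∉ A) (hA : SelfSufficient L (A : Set M))
    (h : (indices X).Nonempty) : predim L (basePart X) < predim L X := by
  have h1 := le_predim_sum X
  rw [sum_eq_sum_indices X (predim L)] at h1
  have h2 := card_links_lt hb h
  have h3 : ∑ _i ∈ indices X, (1 : ℤ) ≤
      ∑ i ∈ indices X, (predim L (copyPart X i) - predim L (basePart X ∩ A)) :=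
    Finset.sum_le_sum fun i hi => by have := predim_lt_copyPart hA hi; omega
  rw [Finset.sum_const, nsmul_eq_mul, mul_one] at h3
  omega

/-- By independence of `J` the base part pays for the links, since a link contains its point of `J`.
The copies other than `i` still contribute at least 1 each. -/
theorem predim_copyPart_add_le (hA : SelfSufficient L (A : Set M))
    (hJ : ∀ X : Finset M, predim L (X ∩ A) + (X ∩ J).card ≤ predim L X)
    {i : Option J} (hi : i ∈ indices X) :
    predim L (copyPart X i) + (indices X).card ≤ predim L X + 1 := by
  have h1 := le_predim_sum X
  rw [sum_eq_sum_indices X (predim L)] at h1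
  have h2 := card_links_le (X := X)
  have h3 : ∑ _i ∈ (indices X).erase i, (1 : ℤ) ≤
      ∑ i ∈ (indices X).erase i, (predim L (copyPart X i) - predim L (basePart X ∩ A)) :=
    Finset.sum_le_sum fun i hi => by
      have := predim_lt_copyPart hA (Finset.mem_of_mem_erase hi); omega
  rw [← Finset.add_sum_erase _ _ hi] at h1
  have h4 := hJ (basePart X)
  have h5 := Finset.card_erase_add_one hi
  rw [Finset.sum_const, nsmul_eq_mul, mul_one] at h3
  omega

/-- With a single copy there is no room for a link, so the amalgam is free here. -/
theorem predim_add_le_of_card_eq_one (hb : b ∉ A) {i : Option J} (hi : indices X = {i}) :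
    predim L (basePart X) + predim L (copyPart X i) ≤ predim L X + predim L (basePart X ∩ A) := by
  have h1 := le_predim_sum X
  rw [sum_eq_sum_indices X (predim L), hi] at h1
  have h2 := card_links_lt (X := X) hb (by simp [hi])
  simp only [hi, Finset.card_singleton, Finset.sum_singleton] at h1 h2
  omega

theorem selfSufficient_range_base (hb : b ∉ A) (hA : SelfSufficient L (A : Set M)) :
    SelfSufficient L (Set.range (base : M → Amalgam A J b R₀)) := by
  refine selfSufficient_iff.2 fun X Z hZ hX => ?_
  have hZ' : Z = (basePart X).map (baseEmb (L := L) hb).toEmbedding := by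
    ext w
    rw [hZ]
    simp only [Finset.mem_map, mem_basePart]
    constructor
    · rintro ⟨hw, m, rfl⟩; exact ⟨m, hw, rfl⟩
    · rintro ⟨m, hw, rfl⟩; exact ⟨hw, m, rfl⟩
  rw [hZ', predim_map]
  refine predim_basePart_lt hb hA (Finset.nonempty_iff_ne_empty.2 fun he => ?_)
  obtain ⟨w, hw, hw'⟩ := hX
  rw [eq_map_of_indices_eq_empty hb he] at hw
  obtain ⟨m, -, rfl⟩ := Finset.mem_map.1 hw
  exact hw' ⟨m, rfl⟩

/-- This is what gives each copy of `b` the type of `b`. With at least two copies met the strict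
gain comes from the others; with only copy `i` met, it comes from a base point outside `A`. -/
theorem selfSufficient_range_copy (hb : b ∉ A) (hA : SelfSufficient L (A : Set M))
    (hJ : ∀ X : Finset M, predim L (X ∩ A) + (X ∩ J).card ≤ predim L X) (i : Option J) :
    SelfSufficient L (Set.range (copy i : M → Amalgam A J b R₀)) := by
  refine selfSufficient_iff.2 fun X Z hZ ⟨w, hw, hw'⟩ => ?_
  have hZ' : Z = (copyPart X i).map (copyEmb (L := L) hb i).toEmbedding := by
    ext w
    rw [hZ]
    simp only [Finset.mem_map, mem_copyPart]
    constructor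
    · rintro ⟨hw, m, rfl⟩; exact ⟨m, hw, rfl⟩
    · rintro ⟨m, hw, rfl⟩; exact ⟨hw, m, rfl⟩
  rw [hZ', predim_map]
  have hbase : (∀ k ∈ indices X, k = i) → predim L (basePart X ∩ A) < predim L (basePart X) := by
    intro hk
    refine hA.predim_lt (by simp) ?_
    rcases base_or_copy w with ⟨m, rfl⟩ | ⟨k, m, hm, rfl⟩
    · exact ⟨m, mem_basePart.2 hw, fun h => hw' ⟨m, copy_of_mem i h⟩⟩
    · have : k ∈ indices X := by
        simp only [indices, Finset.mem_filter, Finset.mem_univ, true_and]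
        exact ⟨m, mem_copyPart.2 hw, hm⟩
      exact absurd ⟨m, by rw [hk k this]⟩ hw'
  by_cases hi : i ∈ indices X
  · by_cases h1 : (indices X).card = 1
    · obtain ⟨k, hk⟩ := Finset.card_eq_one.1 h1
      obtain rfl : i = k := by simpa [hk] using hi
      have h2 := predim_add_le_of_card_eq_one hb hk
      have h3 := hbase (by simp [hk])
      omega
    · have h2 := predim_copyPart_add_le hA hJ hi
      have h3 := Finset.card_pos.2 ⟨i, hi⟩
      omega
  · rw [copyPart_eq_of_notMem hi]
    by_cases he : (indices X).Nonempty
    · have h1 := predim_basePart_lt hb hA he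
      have h2 : predim L (basePart X ∩ A) ≤ predim L (basePart X) := hA.predim_le (by simp)
      omega
    · rw [Finset.not_nonempty_iff_eq_empty] at he
      have h1 := hbase (by simp [he])
      have h2 := predim_map (L := L) (baseEmb (J := J) (R₀ := R₀) hb) (basePart X)
      rw [← eq_map_of_indices_eq_empty hb he] at h2
      omega

/-- The base part gives one lower bound for the predimension and the largest copy part, with the
number of copies met, gives another; together they match the growth estimates. -/
theorem le_predim (hb : b ∉ A) (hA : SelfSufficient L (A : Set M))
    (hJ : ∀ X : Finset M, predim L (X ∩ A) + (X ∩ J).card ≤ predim L X)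
    {f f' : ℝ → ℝ} (hf : IsGood f f') (hf' : ∀ x, 0 ≤ x → f' x ≤ 1 / (2 * (x + 1)))
    (hM : ∀ X : Finset M, f X.card ≤ (predim L X : ℝ)) (X : Finset (Amalgam A J b R₀)) :
    f X.card ≤ (predim L X : ℝ) := by
  rcases (indices X).eq_empty_or_nonempty with he | hne
  · rw [eq_map_of_indices_eq_empty hb he, predim_map, Finset.card_map]
    exact hM _
  obtain ⟨i, hi, hmax⟩ := Finset.exists_max_image (indices X) (fun i => (copyPart X i).card) hne
  have hcard := card_eq X
  rw [sum_eq_sum_indices X fun Y => (Y.card : ℤ)] at hcard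
  have hn : f (basePart X).card + 1 ≤ (predim L X : ℝ) := by
    have h1 : predim L (basePart X) + 1 ≤ predim L X := predim_basePart_lt hb hA hne
    have h2 : ((predim L (basePart X) + 1 : ℤ) : ℝ) ≤ predim L X := by exact_mod_cast h1
    push_cast at h2
    linarith [hM (basePart X)]
  have hm : f (copyPart X i).card + ((indices X).card - 1 : ℕ) ≤ (predim L X : ℝ) := by
    have h1 := predim_copyPart_add_le hA hJ hi
    have h2 := Finset.card_pos.2 hne
    have h3 : predim L (copyPart X i) + ((indices X).card - 1 : ℕ) ≤ predim L X := by omega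
    have h4 : ((predim L (copyPart X i) + ((indices X).card - 1 : ℕ) : ℤ) : ℝ) ≤ predim L X := by
      exact_mod_cast h3
    push_cast at h4 ⊢
    linarith [hM (copyPart X i)]
  by_cases h2 : 2 ≤ (indices X).card
  · refine (hf.map_natCast_mono ?_).trans (hf.map_add_mul_le hf' h2 hn hm)
    have h3 : ∑ i ∈ indices X, (((copyPart X i).card : ℤ) - (basePart X ∩ A).card) ≤
        ∑ _i ∈ indices X, ((copyPart X i).card : ℤ) :=
      Finset.sum_le_sum fun k hk => by have := hmax k hk; omega
    rw [Finset.sum_const, nsmul_eq_mul] at h3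
    zify
    linarith
  -- The estimate for several copies gains nothing from the copy when there is only one; freeness of
  -- the amalgam supplies the missing 1, unless the base part lies in `A` and `X` is just a copy
  -- part.
  · have h3 : (indices X).card = 1 := by have := Finset.card_pos.2 hne; omega
    obtain ⟨k, hk⟩ := Finset.card_eq_one.1 h3
    obtain rfl : i = k := by simpa [hk] using hi
    rw [hk, Finset.sum_singleton] at hcard
    have h4 := predim_add_le_of_card_eq_one hb hk
    by_cases hbA : basePart X ⊆ A
    · rw [Finset.inter_eq_left.2 hbA] at h4 hcard
      have h5 : X.card = (copyPart X i).card := by omega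
      rw [h5]
      refine (hM _).trans ?_
      exact_mod_cast (by omega : predim L (copyPart X i) ≤ predim L X)
    · have h5 : predim L (basePart X ∩ A) < predim L (basePart X) :=
        hA.predim_lt (by simp) (Finset.not_subset.1 hbA)
      refine (hf.map_natCast_mono ?_).trans (hf.map_add_le_of_le_of_le hf' hn
        (m := (copyPart X i).card) ?_)
      · omega
      · have h6 : predim L (copyPart X i) + 1 ≤ predim L X := by omega
        have h7 : ((predim L (copyPart X i) + 1 : ℤ) : ℝ) ≤ predim L X := by exact_mod_cast h6
        push_cast at h7
        linarith [hM (copyPart X i)]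

theorem empty_selfSufficient (hb : b ∉ A) (hA : SelfSufficient L (A : Set M))
    (h₀ : SelfSufficient L (∅ : Set M)) :
    SelfSufficient L (∅ : Set (Amalgam A J b R₀)) := by
  have := SelfSufficient.image (baseEmb (J := J) (R₀ := R₀) hb) (selfSufficient_range_base hb hA) h₀
  simpa using this

end Amalgam

end Amalgam

/-! ### Independent spanning sets and linked realizations -/

section Spanning

open Classical FirstOrder Language Structure

variable {L : FirstOrder.Language.{v, w}} [Fintype (Σ n, L.Relations n)]
  {M : Type u} [L.Structure M] {f : ℝ → ℝ}

theorem IsGeneric.exists_isClosure (hM : IsGeneric L f M) (X : Finset M) :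
    ∃ D : Finset M, IsClosure L X D :=
  let ⟨_, h₀, hX⟩ := hM.exists_selfSufficient X
  HrushovskiGeneric.exists_isClosure h₀ hX

/-- A finite set `Y` is contained in the closure of `A ∪ J` for some `J ⊆ Y` that is independent
over `A`. -/
theorem IsGeneric.exists_independent_spanning (hM : IsGeneric L f M) {A : Finset M}
    (hA : SelfSufficient L (A : Set M)) (Y : Finset M) :
    ∃ J C : Finset M, J ⊆ Y ∧ IsClosure L (A ∪ J) C ∧ Y ⊆ C ∧
      ∀ X : Finset M, predim L (X ∩ A) + (X ∩ J).card ≤ predim L X := by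
  obtain ⟨J, hJ, hmin⟩ := Finset.exists_min_image
    (Y.powerset.filter fun J : Finset M => ∃ C, IsClosure L (A ∪ J) C ∧ Y ⊆ C) Finset.card (by
      obtain ⟨C, hC⟩ := hM.exists_isClosure (A ∪ Y)
      exact ⟨Y, Finset.mem_filter.2 ⟨Finset.mem_powerset_self Y, C, hC,
        Finset.subset_union_right.trans hC.subset⟩⟩)
  simp only [Finset.mem_filter, Finset.mem_powerset] at hJ hmin
  obtain ⟨hJY, C, hC, hYC⟩ := hJ
  refine ⟨J, C, hJY, hC, hYC, ?_⟩
  -- If `j` were in the closure of `A` and the other points, it could be dropped, against minimality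
  -- of `J`.
  have hind : ∀ j ∈ J, ∀ D, IsClosure L (A ∪ J.erase j) D → j ∉ D := by
    intro j hj D hD hjD
    have h1 : A ∪ J ⊆ D := Finset.union_subset (Finset.subset_union_left.trans hD.subset)
      fun k hk => if hkj : k = j then hkj ▸ hjD else
        hD.subset (Finset.mem_union_right _ (Finset.mem_erase.2 ⟨hkj, hk⟩))
    have h2 := hmin (J.erase j) ⟨(Finset.erase_subset _ _).trans hJY, D, hD,
      hYC.trans (hC.least D hD.selfSufficient h1)⟩
    exact absurd (Finset.card_erase_lt_of_mem hj) (not_lt.2 h2)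
  -- Each new point lies outside the closure of `A` and the earlier ones, so it raises the
  -- predimension by at least 1.
  have hgrow : ∀ J' : Finset M, J' ⊆ J → ∀ Z : Finset M, A ∪ J' ⊆ Z →
      predim L A + J'.card ≤ predim L Z := by
    intro J'
    induction J' using Finset.induction_on with
    | empty =>
      intro _ Z hZ
      have hAZ : A ⊆ Z := Finset.subset_union_left.trans hZ
      have : predim L A ≤ predim L Z :=
        hA.predim_le fun m => ⟨fun h => ⟨hAZ h, h⟩, fun h => h.2⟩
      simpa using this
    | insert j J' hj ih =>
      intro hJ' Z hZ
      obtain ⟨D, hD⟩ := hM.exists_isClosure (A ∪ J')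
      obtain ⟨D', hD'⟩ := hM.exists_isClosure (A ∪ J.erase j)
      have hsub : J' ⊆ J.erase j := fun k hk => Finset.mem_erase.2
        ⟨fun h => hj (h ▸ hk), hJ' (Finset.mem_insert_of_mem hk)⟩
      have hjD : j ∉ D := fun h => hind j (hJ' (Finset.mem_insert_self _ _)) D' hD'
        (hD.least D' hD'.selfSufficient
          ((Finset.union_subset_union_right hsub).trans hD'.subset) h)
      have hAZ : A ∪ J' ⊆ Z :=
        (Finset.union_subset_union_right (Finset.subset_insert _ _)).trans hZ
      have h1 := ih (hsub.trans (Finset.erase_subset _ _)) (Z ∩ D)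
        (Finset.subset_inter hAZ hD.subset)
      have h2 : predim L (Z ∩ D) < predim L Z := hD.selfSufficient.predim_lt (by simp)
        ⟨j, hZ (Finset.mem_union_right _ (Finset.mem_insert_self _ _)), hjD⟩
      rw [Finset.card_insert_of_notMem hj]
      push_cast
      omega
  intro X
  have h1 := hgrow (X ∩ J) Finset.inter_subset_right (X ∪ A) (Finset.union_subset
    Finset.subset_union_right (Finset.inter_subset_left.trans Finset.subset_union_left))
  have h2 := predim_submodular (L := L) X A
  omega

/-- If the points of `J` not in `K` are linked to points of `K` outside `C`, and `C` is spanned by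
the independent set `J` over `A`, then `C ⊆ K`. -/
theorem subset_of_linked {A C J K : Finset M} (hC : IsClosure L (A ∪ J) C)
    (hJ : ∀ X : Finset M, predim L (X ∩ A) + (X ∩ J).card ≤ predim L X)
    (hK : SelfSufficient L (K : Set M)) (hAK : A ⊆ K) {R₀ : L.Relations 3} {p : M} {z : J → M}
    (hp : p ∈ K) (hpC : p ∉ C) (hz : ∀ j, z j ∈ K) (hR : ∀ j : J, RelMap R₀ ![p, z j, j]) :
    C ⊆ K := by
  -- Only points outside `K` yield a new fact in `K ∪ C`; those in `K` count towards the
  -- predimension of `K ∩ C` instead.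
  set J₀ : Finset J := Finset.univ.filter fun j => (j : M) ∉ K with hJ₀
  set link : J → Fact L M := fun j => ⟨⟨3, R₀⟩, ![p, z j, j]⟩ with hlink
  have hinj : Function.Injective link := fun i j h => by
    simp only [hlink, Sigma.mk.injEq, heq_eq_eq, true_and] at h
    exact Subtype.ext (congrFun h 2)
  have hJC : J ⊆ C := Finset.subset_union_right.trans hC.subset
  have hAC : A ⊆ C := Finset.subset_union_left.trans hC.subset
  have h1 := predim_union_le_of_facts (L := L) (X := K) (Y := C) (G := J₀.image link) (by
    intro q hq
    obtain ⟨j, hj, rfl⟩ := Finset.mem_image.1 hq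
    refine ⟨mem_facts.2 ⟨hR j, fun k => ?_⟩, fun h => ?_, fun h => ?_⟩
    · have : ∀ k : Fin 3, (![p, z j, j] : Fin 3 → M) k ∈ K ∪ C := by
        rw [Fin.forall_fin_succ, Fin.forall_fin_two]
        exact ⟨Finset.mem_union_left _ hp, Finset.mem_union_left _ (hz j),
          Finset.mem_union_right _ (hJC j.2)⟩
      exact this k
    · exact (Finset.mem_filter.1 hj).2 ((mem_facts.1 h).2 (2 : Fin 3))
    · exact hpC ((mem_facts.1 h).2 (0 : Fin 3)))
  rw [Finset.card_image_of_injective _ hinj] at h1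
  have h2 := hJ (K ∩ C)
  have e1 : K ∩ C ∩ A = A := Finset.inter_eq_right.2 (Finset.subset_inter hAK hAC)
  have e2 : (K ∩ C ∩ J).card + J₀.card = J.card := by
    have e3 : J₀.card = (J \ K).card := by
      rw [← Finset.card_map (Function.Embedding.subtype (· ∈ J))]
      congr 1
      ext m
      simp [hJ₀, and_comm]
    have e4 : K ∩ C ∩ J = J ∩ K := by
      ext m
      simp only [Finset.mem_inter]
      exact ⟨fun h => ⟨h.2, h.1.1⟩, fun h => ⟨⟨h.2, hJC h.1⟩, h.1⟩⟩
    rw [e3, e4, Finset.card_inter_add_card_sdiff]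
  have h3 := hC.predim_le (subset_refl (A ∪ J))
  have h4 := predim_union_le_add_card (L := L) A J
  rw [e1] at h2
  -- Now δ(K ∪ C) ≤ δ(K) + (δ(A) + |J|) − (δ(A) + |J ∩ K|) − |J \ K| = δ(K), against
  -- self-sufficiency of `K`.
  by_contra hn
  obtain ⟨m, hm, hmK⟩ := Finset.not_subset.1 hn
  have h5 : predim L K < predim L (K ∪ C) := hK.predim_lt
    (fun m => ⟨fun h => ⟨Finset.mem_union_left _ h, h⟩, fun h => h.2⟩)
    ⟨m, Finset.mem_union_right _ hm, hmK⟩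
  omega

variable [L.IsRelational]

/-- There are realizations of the type of `b` over a subset `S` of `A`, indexed by `Option J`, each of which with
index in `J` is linked to its index and to the central one. -/
theorem IsGeneric.exists_linked (hM : IsGeneric L f M) {f' : ℝ → ℝ} (hf : IsGood f f')
    (hf' : ∀ x, 0 ≤ x → f' x ≤ 1 / (2 * (x + 1))) (R₀ : L.Relations 3)
    {A C J : Finset M} (hA : SelfSufficient L (A : Set M)) {S : Set M} (hS : S ⊆ A) {b : M} (hb : b ∉ A)
    (hC : IsClosure L (A ∪ J) C)
    (hJ : ∀ X : Finset M, predim L (X ∩ A) + (X ∩ J).card ≤ predim L X) :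
    ∃ x : Option J → M, (∀ i, x i ∈ loc L S b) ∧ (∀ i, x i ∉ C) ∧
      ∀ j : J, RelMap R₀ ![x none, x (some j), j] := by
  obtain ⟨B, hB, hAB⟩ := hM.exists_selfSufficient (insert b A)
  have hJC : J ⊆ C := Finset.subset_union_right.trans hC.subset
  have hAC : A ⊆ C := Finset.subset_union_left.trans hC.subset
  let W := Amalgam A J b R₀
  -- The amalgam is built from all of `M`; the extension property needs only the finite part made of
  -- `C` and the copies of `B`.
  let E : Finset W := C.image Amalgam.base ∪ Finset.univ.biUnion fun i => B.image (Amalgam.copy i)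
  let N : L.Substructure W := substructureOf L (E : Set W)
  have : Finite N := E.finite_toSet.to_subtype
  have hN : MemKf L f N := memKf_of_embedding N.subtype
    (Amalgam.empty_selfSufficient hb hA hM.empty_selfSufficient)
    (Amalgam.le_predim hb hA hJ hf hf' hM.le_predim)
  have hbase : ∀ c ∈ C, (Amalgam.base c : W) ∈ N := fun c hc =>
    Finset.mem_union_left _ (Finset.mem_image_of_mem _ hc)
  have hcopy : ∀ i, ∀ c ∈ B, (Amalgam.copy i c : W) ∈ N := fun i c hc =>
    Finset.mem_union_right _ (Finset.mem_biUnion.2 ⟨i, Finset.mem_univ _,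
      Finset.mem_image_of_mem _ hc⟩)
  let base : C → N := fun c => ⟨Amalgam.base c, hbase c c.2⟩
  let copy : Option J → B → N := fun i c => ⟨Amalgam.copy i c, hcopy i c c.2⟩
  have hbaseSS : SelfSufficient L (Set.range base) := by
    have h1 := SelfSufficient.image (Amalgam.baseEmb (J := J) (R₀ := R₀) hb)
      (Amalgam.selfSufficient_range_base hb hA) hC.selfSufficient
    convert h1.preimage N.subtype using 1
    ext n
    constructor
    · rintro ⟨c, rfl⟩; exact ⟨c, c.2, rfl⟩
    · rintro ⟨c, hc, e⟩; exact ⟨⟨c, hc⟩, Subtype.ext e⟩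
  have hcopySS : ∀ i, SelfSufficient L (Set.range (copy i)) := fun i => by
    have h1 := SelfSufficient.image (Amalgam.copyEmb (J := J) (R₀ := R₀) hb i)
      (Amalgam.selfSufficient_range_copy hb hA hJ i) hB
    convert h1.preimage N.subtype using 1
    ext n
    constructor
    · rintro ⟨c, rfl⟩; exact ⟨c, c.2, rfl⟩
    · rintro ⟨c, hc, e⟩; exact ⟨⟨c, hc⟩, Subtype.ext e⟩
  obtain ⟨β, hβ, hβbase⟩ := hM.exists_extension hN (u := base) (u' := fun c : C => (c : M))
    (fun i j => Subtype.ext_iff.trans Amalgam.base_injective.eq_iff)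
    (fun R t => (Amalgam.baseEmb (J := J) (R₀ := R₀) hb).map_rel R.2 fun k => (t k : M))
    hbaseSS (by convert hC.selfSufficient using 1; exact Subtype.range_coe)
  have hsim : ∀ i, Similar L (fun c : B => (c : M)) fun c => β (copy i c) := fun i => by
    refine ⟨fun c c' => ?_, fun R t => ?_, ?_, ?_⟩
    · rw [β.injective.eq_iff]
      exact (Subtype.ext_iff.trans (Amalgam.copy_injective i).eq_iff).symm
    · refine Iff.trans ?_ (β.map_rel R.2 fun k => copy i (t k)).symm
      exact ((Amalgam.copyEmb (J := J) (R₀ := R₀) hb i).map_rel R.2 fun k => (t k : M)).symm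
    · convert hB using 1; exact Subtype.range_coe
    · have := SelfSufficient.image β hβ (hcopySS i)
      rwa [← Set.range_comp] at this
  have hbB : b ∈ B := hAB (Finset.mem_insert_self _ _)
  refine ⟨fun i => β (copy i ⟨b, hbB⟩), fun i => ?_, fun i hi => ?_, fun j => ?_⟩
  · refine hM.mem_loc (hsim i) (fun a ha => ?_) ⟨b, hbB⟩
    refine ⟨⟨a, hAB (Finset.mem_insert_of_mem (hS ha))⟩, rfl, ?_⟩
    exact (congrArg β (Subtype.ext (Amalgam.copy_of_mem i (hS ha)))).trans
      (hβbase ⟨a, hAC (hS ha)⟩)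
  · have h1 := β.injective (hβbase ⟨_, hi⟩).symm
    exact hb (Amalgam.copy_eq_base.1 (congrArg Subtype.val h1)).2
  · have h1 : RelMap R₀ ![copy none ⟨b, hbB⟩, copy (some j) ⟨b, hbB⟩, base ⟨j, hJC j.2⟩] := by
      refine (N.subtype.map_rel R₀ _).1 (Or.inr (Or.inr ⟨j, ?_⟩))
      refine congrArg (Sigma.mk _) (funext fun k => ?_)
      fin_cases k <;> rfl
    have h2 := (β.map_rel R₀ _).2 h1
    convert h2 using 1
    funext k
    fin_cases k
    · rfl
    · rfl
    · exact (hβbase ⟨j, hJC j.2⟩).symm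

end Spanning

end HrushovskiGeneric
-- The theorem
theorem proposition4p4
    (L : FirstOrder.Language.{v, w}) [L.IsRelational] [Fintype (Σ n, L.Relations n)]
    (hR : Nonempty (L.Relations 3))
    (f f' : ℝ → ℝ) (hf : HrushovskiGeneric.IsGood f f')
    (hf' : ∀ x, 0 ≤ x → f' x ≤ 1 / (2 * (x + 1)))
    (M : Type u) [L.Structure M] (hM : HrushovskiGeneric.IsGeneric L f M)
    (k : ℕ) (a : Fin k → M) (b : M)
    (hb : b ∉ HrushovskiGeneric.acl L (Set.range a))
    (r : ℕ) (y : Fin r → M) :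
    ∃ x : Fin (r + 2) → M,
      (∀ i, x i ∈ HrushovskiGeneric.loc L (Set.range a) b) ∧
      ∀ j, y j ∈ HrushovskiGeneric.acl L (Set.range x ∪ Set.range a) := by
  classical
  obtain ⟨R₀⟩ := hR
  obtain ⟨A, hA⟩ := hM.exists_isClosure (Finset.univ.image a)
  have haA : Set.range a ⊆ A := by
    simpa using Finset.coe_subset.2 hA.subset
  have hbA : b ∉ A := fun h => hb (by simpa using hA.subset_acl h)
  obtain ⟨J, C, hJy, hC, hyC, hJ⟩ :=
    hM.exists_independent_spanning hA.selfSufficient (Finset.univ.image y)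
  obtain ⟨x, hx, hxC, hxR⟩ := hM.exists_linked hf hf' R₀ hA.selfSufficient haA hbA hC hJ
  -- Since `|J| ≤ r`, the linked realizations number at most `r + 1`; repetitions pad them to a
  -- tuple of length `r + 2`.
  have hcard : Fintype.card (Option J) ≤ Fintype.card (Fin (r + 2)) := by
    have h1 := (Finset.card_le_card hJy).trans Finset.card_image_le
    simp only [Fintype.card_option, Fintype.card_coe, Fintype.card_fin, Finset.card_univ] at h1 ⊢
    omega
  obtain ⟨e⟩ := Function.Embedding.nonempty_of_card_le hcard
  set g : Fin (r + 2) → Option J := Function.invFun e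
  have hg : Function.Surjective g := Function.invFun_surjective e.injective
  refine ⟨x ∘ g, fun i => hx (g i), fun j => ?_⟩
  obtain ⟨K, hK⟩ := hM.exists_isClosure (Finset.univ.image (x ∘ g) ∪ Finset.univ.image a)
  have hxK : ∀ i, x i ∈ K := fun i => by
    obtain ⟨l, rfl⟩ := hg i
    exact hK.subset (Finset.mem_union_left _ (Finset.mem_image_of_mem (x ∘ g) (Finset.mem_univ l)))
  have hAK : A ⊆ K := hA.least K hK.selfSufficient (Finset.subset_union_right.trans hK.subset)
  have hCK : C ⊆ K := HrushovskiGeneric.subset_of_linked hC hJ hK.selfSufficient hAK (hxK none)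
    (hxC none) (fun j => hxK (some j)) hxR
  have := hK.subset_acl (hCK (hyC (Finset.mem_image_of_mem y (Finset.mem_univ j))))
  simpa only [Finset.coe_union, Finset.coe_image, Finset.coe_univ, Set.image_univ] using this
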